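/- Consider $K\ge 1$ agents with combination matrix $A=[a_{mk}]\in\mathbb{R}^{K\times K}$ that is symmetric, doubly stochastic with nonnegative entries, and primitive (e.g. a connected network in which some agent has a positive self-weight); $\mathcal N_k=\{m: a_{mk}>0\}$. Agent $k$ has a loss $Q_k(w;x)$, $w\in\mathbb{R}^M$, a data set $\{x_{k,n}\}_{n=1}^{N_k}$, $N_k\ge1$, and the empirical risk $J_k(w)=\frac1{N_k}\sum_n Q_k(w;x_{k,n})$. Let $w^o=\arg\min_w\frac1K\sum_kJ_k(w)$ and $w_k^o=\arg\min_w J_k(w)$. Assume, for some $\nu,\delta>0$, that each $J_k$ is $\nu$-strongly convex and that the losses $Q_k(\cdot\,;x_{k,n})$ are convex, twice differentiable and have $\delta$-Lipschitz gradients; and that the model drift is bounded, $\|w^o-w_k^o\|\le\xi$ for all $k$. *Algorithm.* With step size $\mu>0$, the privatized adapt-then-combine (ATC) diffusion strategy is $$\boldsymbol\psi_{k,i}=\boldsymbol w_{k,i-1}-\mu\nabla Q_k(\boldsymbol w_{k,i-1};\boldsymbol x_{k,b}),\qquad \boldsymbol w_{k,i}=\sum_{m\in\mathcal N_k}a_{mk}\big(\boldsymbol\psi_{m,i}+\boldsymbol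 g_{mk,i}\big),$$ where $\boldsymbol x_{k,b}$ is drawn at each iteration uniformly from the data set of agent $k$, the draws of each iteration being jointly independent of the initial models and of all earlier draws, and the initial models have finite second moments. The noises come from the local graph-homomorphic process: at each iteration each agent $k$ splits $\mathcal N_k=\mathcal N_+\sqcup\mathcal N_-$; each pair $\ell\in\mathcal N_+$, $m\in\mathcal N_-$ generates (coordinatewise) $\boldsymbol g_{\{\ell m\}k,i}=\frac{\sigma_g}{\sqrt2}\ln(\boldsymbol v_{\ell m}/\boldsymbol v'_{\ell m})$ from shared keys $\boldsymbol v_{\ell m}=ae^{-\boldsymbol v_\ell\boldsymbol v_m}\bmod p$, $\boldsymbol v'_{\ell m}=ae^{-\boldsymbol v'_\ell\boldsymbol v'_m}\bmod p$ ($p$ prime, $a$ a positive integer multiple of $p$), with mutually independent secret keys $\boldsymbol v_\ell,\boldsymbol v'_\ell\sim U([0,1])$ and $\boldsymbol v_m,\boldsymbol v'_m\sim\Gamma(2,1)$; and $\boldsymbol g_{\ell k,i}=\frac1{a_{\ell k}}\sum_{m\in\mathcal N_-}\boldsymbol g_{\{\ell m\}k,i}$ for $\ell\in\mathcal N_+$,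 $\boldsymbol g_{mk,i}=-\frac1{a_{mk}}\sum_{\ell\in\mathcal N_+}\boldsymbol g_{\{\ell m\}k,i}$ for $m\in\mathcal N_-$. *Notation.* $\widetilde{\boldsymbol w}_i=\mathrm{col}\{w^o-\boldsymbol w_{k,i}\}_k$. Let $\rho(\cdot)$ denote the spectral radius, and let $A=\frac1K\mathbb 1\mathbb 1^{\sf T}+V_RJ_\epsilon V_R^{\sf T}$ be an orthogonal eigendecomposition ($V_R\in\mathbb{R}^{K\times(K-1)}$, $V_R^{\sf T}V_R=I$, $\mathbb 1^{\sf T}V_R=0$, $J_\epsilon$ diagonal). Let $\check b=\mu\,(V_R^{\sf T}A^{\sf T}\otimes I_M)\,\mathrm{col}\{\nabla J_k(w^o)\}_k$. Let $\beta^2\ge0$ and $\sigma_s^2$ bound the variance of the gradient noise: for all $w_1,\dots,w_K\in\mathbb{R}^M$, $$\sum_k\frac1{N_k}\sum_n\|\nabla Q_k(w_k;x_{k,n})-\nabla J_k(w_k)\|^2\le\beta^2\sum_k\|w^o-w_k\|^2+\sigma_s^2 .$$ **Theorem (MSE convergence).** Such a gradient-noise bound always exists: $\beta^2=2\delta^2$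 and $\sigma_s^2=2\sum_k\frac1{N_k}\sum_n\|\nabla Q_k(w^o;x_{k,n})-\nabla J_k(w^o)\|^2$ are admissible. There are $V_R,J_\epsilon$ as above with $\rho(J_\epsilon)<1$ and constants $v_1,v_2>0$ depending only on $A$ such that, for every $\epsilon>0$ with $\rho(J_\epsilon)+\epsilon<1$ and all $\nu,\delta>0$, $\beta^2\ge 0$, there are constants $c_1>0$, $c_2,\dots,c_5\ge0$, $\mu_0>0$, $C,C'\ge0$ depending only on $A,\epsilon,\nu,\delta,\beta^2$ for which the following holds. For $0<\mu\le\mu_0$ the matrix $$\Gamma=\begin{bmatrix}1-c_1\mu+c_2\mu^2& c_3\mu^{1/2}\\ c_4\mu&\sqrt{\rho(J_\epsilon)+\epsilon}+c_5\mu^2\end{bmatrix}$$ satisfies $\rho(\Gamma)<1$. Moreover, for every problem as above with these $\nu,\delta$, every $\xi$ bounding the drift, every $\sigma_s^2$ such that $(\beta^2,\sigma_s^2)$ is a gradient-noise bound, and every $0<\mu\le\mu_0$, setting $$B=v_2^2\,\mathbb 1^{\sf T}(I-\Gamma)^{-1}\begin{bmatrix}v_1^2\mu^2\sigma_s^2\\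 v_1^2\mu^2\sigma_s^2+\frac{3\|\check b\|^2}{1-\rho(J_\epsilon)-\epsilon}\end{bmatrix},$$ one has $B\le C'(\sigma_s^2+\xi^2)\mu$, and, for every $\sigma_g>0$, every choice of the noise process, of the initial models and of the sampling, $\mathbb E\|\widetilde{\boldsymbol w}_i\|^2$ is finite for all $i$, $$\mathbb E\|\widetilde{\boldsymbol w}_i\|^2\le C\,\rho(\Gamma)^i\,\mathbb E\|\widetilde{\boldsymbol w}_0\|^2+B\quad\text{for all } i,\qquad \limsup_{i\to\infty}\mathbb E\|\widetilde{\boldsymbol w}_i\|^2\le B .$$ In particular the strategy converges exponentially fast to an $O(\mu)$ neighbourhood of $w^o$ that does not depend on $\sigma_g^2$. -/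

import Mathlib

open MeasureTheory ProbabilityTheory Filter
open scoped Matrix ENNReal RealInnerProductSpace Gradient

/-- The parameter space `ℝ^M` with its Euclidean norm. -/
abbrev Param (M : ℕ) : Type := EuclideanSpace ℝ (Fin M)

/-! ### The network -/

/-- `A` is an admissible combination matrix: symmetric, doubly stochastic (in particular
entrywise nonnegative), and primitive, i.e. some power of `A` is entrywise positive. Connected
networks in which at least one agent has a positive self-weight have a primitive matrix. -/
structure IsCombinationMatrix {K : ℕ} (A : Matrix (Fin K) (Fin K) ℝ) : Prop where
  symm : A.IsSymm
  stochastic : A ∈ doublyStochastic ℝ (Fin K)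
  primitive : A.IsPrimitive

open Classical in
/-- The neighbourhood `𝒩_k`: the agents `m` whose messages receive a weight `a_{mk} > 0`
from agent `k`. -/
noncomputable def neighbourhood {K : ℕ} (A : Matrix (Fin K) (Fin K) ℝ) (k : Fin K) :
    Finset (Fin K) :=
  Finset.univ.filter fun m => 0 < A m k

/-- The spectral radius of a real square matrix: the largest modulus of a complex eigenvalue
(`0` for the empty matrix). -/
noncomputable def specRad {n : Type*} [Fintype n] [DecidableEq n] (B : Matrix n n ℝ) : ℝ :=
  (spectralRadius ℂ (B.map (fun t : ℝ => (t : ℂ)))).toReal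

/-- The eigendecomposition `A = K⁻¹ 𝟙𝟙ᵀ + V_R J_ε V_Rᵀ`: the columns of `V_R` are orthonormal
and orthogonal to `𝟙`, and `J_ε` is the Jordan matrix of the eigenvalues of `A` other than the
simple eigenvalue `1`. It is diagonal because `A` is symmetric. -/
structure IsEigendecomposition {K : ℕ} (A : Matrix (Fin K) (Fin K) ℝ)
    (VR : Matrix (Fin K) (Fin (K - 1)) ℝ) (Jε : Matrix (Fin (K - 1)) (Fin (K - 1)) ℝ) : Prop where
  isDiag : Jε.IsDiag
  orthonormal : VRᵀ * VR = 1
  orthogonal_one : ∀ j, ∑ k, VR k j = 0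
  eq : A = Matrix.of (fun _ _ => (K : ℝ)⁻¹) + VR * Jε * VRᵀ

/-! ### The optimization problem -/

/-- The data of the learning problem: agent `k` has a loss function `Q_k(w; x)` and a non-empty
local data set `x_{k,1}, …, x_{k,N_k}` of points of `X`. -/
structure LearningProblem (K M : ℕ) (X : Type*) where
  N : Fin K → ℕ
  N_pos : ∀ k, 0 < N k
  loss : Fin K → Param M → X → ℝ
  data : (k : Fin K) → Fin (N k) → X

namespace LearningProblem

variable {K M : ℕ} {X : Type*} (L : LearningProblem K M X)

/-- The loss `w ↦ Q_k(w; x_{k,n})` at the `n`-th sample of agent `k`. -/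
def sampleLoss (k : Fin K) (n : Fin (L.N k)) (w : Param M) : ℝ :=
  L.loss k w (L.data k n)

/-- The empirical risk `J_k(w) = N_k⁻¹ ∑ₙ Q_k(w; x_{k,n})`. -/
noncomputable def risk (k : Fin K) (w : Param M) : ℝ :=
  (L.N k : ℝ)⁻¹ * ∑ n, L.sampleLoss k n w

/-- The aggregate risk `K⁻¹ ∑ₖ J_k(w)`. -/
noncomputable def aggregateRisk (w : Param M) : ℝ :=
  (K : ℝ)⁻¹ * ∑ k, L.risk k w

/-- Convexity and smoothness: `ν`-strongly convex empirical risks, and convex, twice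
differentiable losses with `δ`-Lipschitz gradients. -/
structure ConvexSmooth (ν δ : ℝ) : Prop where
  risk_stronglyConvex : ∀ k w₁ w₂,
    L.risk k w₁ + ⟪∇ (L.risk k) w₁, w₂ - w₁⟫ + ν / 2 * ‖w₂ - w₁‖ ^ 2 ≤ L.risk k w₂
  loss_differentiable : ∀ k n, Differentiable ℝ (L.sampleLoss k n)
  loss_twice_differentiable : ∀ k n, Differentiable ℝ (∇ (L.sampleLoss k n))
  loss_convex : ∀ k n w₁ w₂,
    L.sampleLoss k n w₁ + ⟪∇ (L.sampleLoss k n) w₁, w₂ - w₁⟫ ≤ L.sampleLoss k n w₂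
  loss_lipschitz : ∀ k n w₁ w₂,
    ‖∇ (L.sampleLoss k n) w₂ - ∇ (L.sampleLoss k n) w₁‖ ≤ δ * ‖w₂ - w₁‖

/-- `wo` is the global optimal model, `wloc k` are the local optimal models, and each of the
latter lies within distance `ξ` of the former. -/
structure BoundedDrift (wo : Param M) (wloc : Fin K → Param M) (ξ : ℝ) : Prop where
  global_optimal : IsMinOn L.aggregateRisk Set.univ wo
  local_optimal : ∀ k, IsMinOn (L.risk k) Set.univ (wloc k)
  drift : ∀ k, ‖wo - wloc k‖ ≤ ξ

/-- The variance of the gradient noise `∇Q_k(w; x_{k,b}) - ∇J_k(w)` of agent `k` at the model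
`w`, where the index `b` is uniform on `{1, …, N_k}`. -/
noncomputable def gradientNoiseVariance (k : Fin K) (w : Param M) : ℝ :=
  (L.N k : ℝ)⁻¹ * ∑ n, ‖∇ (L.sampleLoss k n) w - ∇ (L.risk k) w‖ ^ 2

/-- `σs2` (written `σ_s²`) bounds the variance of the gradient noise of the network, up to a
relative term with factor `β2`. -/
def IsGradientNoiseBound (wo : Param M) (β2 σs2 : ℝ) : Prop :=
  ∀ w : Fin K → Param M,
    ∑ k, L.gradientNoiseVariance k (w k) ≤ β2 * ∑ k, ‖wo - w k‖ ^ 2 + σs2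

/-- The bias vector `b̌ = μ (V_Rᵀ Aᵀ ⊗ I) col{∇J_k(wᵒ)}`, with `K - 1` blocks in `ℝ^M`. -/
noncomputable def bias (A : Matrix (Fin K) (Fin K) ℝ) (VR : Matrix (Fin K) (Fin (K - 1)) ℝ)
    (μ : ℝ) (wo : Param M) (j : Fin (K - 1)) : Param M :=
  μ • ∑ k, VR k j • ∑ m, A m k • ∇ (L.risk m) wo

end LearningProblem

/-! ### The local graph-homomorphic process -/

/-- The real number `y` reduced modulo `p`, a number in `[0, p)`. -/
noncomputable def realMod (y p : ℝ) : ℝ := p * Int.fract (y / p)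

/-- Labels of the secret keys: at iteration `iter`, the pair `(plus, minus)` of neighbours of
the agent `center` uses, for each coordinate of the noise, a first (`second = false`) and a
second (`second = true`) key exchange. -/
structure KeyLabel (K M : ℕ) where
  iter : ℕ
  center : Fin K
  plus : Fin K
  minus : Fin K
  coord : Fin M
  second : Bool

/-- A local graph-homomorphic process on the network with combination matrix `A`, with noises
in `ℝ^M`. At each iteration each agent `k` splits its neighbourhood (possibly at random) into
`posGroup i k` and the rest, and every pair formed by an agent of the first group and one of the
second draws independent secret keys, uniform on `[0,1]` and `Γ(2,1)` respectively. -/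
structure LocalGraphHomomorphicProcess {K : ℕ} (A : Matrix (Fin K) (Fin K) ℝ) (M : ℕ)
    {Ω : Type*} [MeasurableSpace Ω] (P : Measure Ω) where
  /-- The public prime. -/
  p : ℕ
  prime : p.Prime
  /-- The public scaling constant, a positive multiple of the prime. -/
  a : ℕ
  a_pos : 0 < a
  dvd : p ∣ a
  /-- The group `𝒩₊` of the neighbourhood of `k`; `𝒩₋` is its complement in `𝒩_k`. -/
  posGroup : ℕ → Fin K → Ω → Finset (Fin K)
  posGroup_subset : ∀ i k ω, posGroup i k ω ⊆ neighbourhood A k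
  posGroup_measurable : ∀ i k s, MeasurableSet {ω | posGroup i k ω = s}
  /-- The secret keys of the agents in `𝒩₊`. -/
  plusKey : KeyLabel K M → Ω → ℝ
  /-- The secret keys of the agents in `𝒩₋`. -/
  minusKey : KeyLabel K M → Ω → ℝ
  plusKey_law : ∀ l, HasLaw (plusKey l) (volume.restrict (Set.Icc (0 : ℝ) 1)) P
  minusKey_law : ∀ l, HasLaw (minusKey l) (gammaMeasure 2 1) P
  keys_independent : iIndepFun (Sum.elim plusKey minusKey) P

namespace LocalGraphHomomorphicProcess

variable {K M : ℕ} {A : Matrix (Fin K) (Fin K) ℝ} {Ω : Type*} [MeasurableSpace Ω] {P : Measure Ω}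
  (G : LocalGraphHomomorphicProcess A M P)

/-- The shared secret key `a e^{-v_ℓ v_m} mod p`. -/
noncomputable def sharedKey (l : KeyLabel K M) (ω : Ω) : ℝ :=
  realMod (G.a * Real.exp (-(G.plusKey l ω * G.minusKey l ω))) G.p

/-- The noise `g_{{ℓm}k,i}` generated by the pair `ℓ ∈ 𝒩₊`, `m ∈ 𝒩₋` of neighbours of `k`: each
coordinate is `σ_g/√2` times the logarithm of the quotient of two shared keys (a Laplace variable
of variance `σ_g²`). -/
noncomputable def pairNoise (σg : ℝ) (i : ℕ) (k ℓ m : Fin K) (ω : Ω) : Param M :=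
  WithLp.toLp 2 fun d => σg / √2 *
    Real.log (G.sharedKey ⟨i, k, ℓ, m, d, false⟩ ω / G.sharedKey ⟨i, k, ℓ, m, d, true⟩ ω)

/-- The noise `g_{mk,i}` that agent `m` adds to the message it sends to agent `k`: the sum of the
pair noises it generated with the other group, with the sign of its own group, scaled by the
inverse of the weight `a_{mk}`. -/
noncomputable def noise (σg : ℝ) (i : ℕ) (m k : Fin K) (ω : Ω) : Param M :=
  if m ∈ G.posGroup i k ω then
    (A m k)⁻¹ • ∑ ℓ ∈ neighbourhood A k \ G.posGroup i k ω, G.pairNoise σg i k m ℓ ω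
  else
    -((A m k)⁻¹ • ∑ ℓ ∈ G.posGroup i k ω, G.pairNoise σg i k ℓ m ω)

end LocalGraphHomomorphicProcess

/-! ### The privatized diffusion algorithm -/

/-- The random sample indices `draw k i` used by agent `k` in the step from time `i` to time
`i + 1`: they are uniform on the local data set, and the draws of one iteration are jointly
independent of the initial models and of all the earlier draws. -/
structure IsUniformSampling {K M : ℕ} {X : Type*} (L : LearningProblem K M X)
    {Ω : Type*} [MeasurableSpace Ω] (P : Measure Ω)
    (init : Ω → Fin K → Param M) (draw : (k : Fin K) → ℕ → Ω → Fin (L.N k)) : Prop where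
  measurable : ∀ k i, Measurable (draw k i)
  uniform : ∀ k i n, P {ω | draw k i ω = n} = (L.N k : ℝ≥0∞)⁻¹
  independent : ∀ i : ℕ, IndepFun (fun ω (k : Fin K) => draw k i ω)
    (fun ω => (init ω, fun (j : Fin i) (k : Fin K) => draw k j ω)) P

/-- The privatized adapt-then-combine diffusion strategy with step size `μ`:
`ψ_{m} = w_{m,i} - μ ∇Q_m(w_{m,i}; x_{m,b})` and
`w_{k,i+1} = ∑_{m ∈ 𝒩_k} a_{mk} (ψ_m + g_{mk})`. -/
noncomputable def privatizedATC {K M : ℕ} {X : Type*} (L : LearningProblem K M X)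
    (A : Matrix (Fin K) (Fin K) ℝ) {Ω : Type*} [MeasurableSpace Ω] {P : Measure Ω}
    (G : LocalGraphHomomorphicProcess A M P) (σg : ℝ) (init : Ω → Fin K → Param M)
    (draw : (k : Fin K) → ℕ → Ω → Fin (L.N k)) (μ : ℝ) : ℕ → Ω → Fin K → Param M
  | 0, ω => init ω
  | i + 1, ω => fun k => ∑ m ∈ neighbourhood A k, A m k •
      ((privatizedATC L A G σg init draw μ i ω m
          - μ • ∇ (L.sampleLoss m (draw m i ω)) (privatizedATC L A G σg init draw μ i ω m))
        + G.noise σg i m k ω)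

/-- The squared norm of the network error `w̃ = col{wᵒ - w_k}`. -/
noncomputable def sqError {K M : ℕ} (wo : Param M) (w : Fin K → Param M) : ℝ :=
  ∑ k, ‖wo - w k‖ ^ 2

/-! ### The bound -/

/-- The rate matrix `Γ`, with `τ = ρ(J_ε) + ε` and explicit constants in the `O`-terms. -/
noncomputable def rateMatrix (c₁ c₂ c₃ c₄ c₅ τ μ : ℝ) : Matrix (Fin 2) (Fin 2) ℝ :=
  !![1 - c₁ * μ + c₂ * μ ^ 2, c₃ * √μ;
     c₄ * μ, √τ + c₅ * μ ^ 2]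

/-- The bound `v₂² 𝟙ᵀ (I - Γ)⁻¹ [v₁² μ² σ_s² ; v₁² μ² σ_s² + 3‖b̌‖² / (1 - τ)]`, with
`τ = ρ(J_ε) + ε` and `bsq = ‖b̌‖²`. -/
noncomputable def mseBound (v₁ v₂ : ℝ) (Γ : Matrix (Fin 2) (Fin 2) ℝ) (τ μ σs2 bsq : ℝ) : ℝ :=
  v₂ ^ 2 * ((1 : Fin 2 → ℝ) ⬝ᵥ ((1 - Γ)⁻¹ *ᵥ
    ![v₁ ^ 2 * μ ^ 2 * σs2, v₁ ^ 2 * μ ^ 2 * σs2 + 3 * bsq / (1 - τ)]))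

/-! The privacy noise cancels path by path. In the combination at agent `k` the weight `a_{mk}`
undoes the scaling by its inverse, and each pair noise then occurs once with each sign
(`LocalGraphHomomorphicProcess.sum_smul_noise`). The privatized iterates are therefore those of
plain diffusion (`privatizedATC_eq_diffusionATC`), so no bound can involve the law or the size of
the noise.

For plain diffusion, the squared error splits by Parseval into a centroid part, along the consensus
direction, and a disagreement part, along the columns of `V_R`. Double stochasticity makes the
centroid perform an averaged gradient step; since the local gradients sum to zero at the global
minimizer, strong convexity contracts it by about `1 - νμ`, up to an error controlled by the
disagreement. The j-th disagreement coordinate is multiplied by the eigenvalue `J j j`, of modulus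
at most `τ < 1`, up to Lipschitz terms and the bias, which is `O(μ)` because of the drift bound. The
sampling noise is centred given the past, so it enters only through `μ²` times its variance
(`integral_le_of_gradientNoise`).

The two expected energies thus obey a nonnegative affine recursion dominated by `Γ`
(`integral_diffusionStep_le`, `rate_coefficients_le`). For small `μ` its eigenvalues stay a fixed
distance apart, so the powers of `Γ` are bounded by `ρ(Γ)^i` with a constant free of `μ`, and the
fixed point of the recursion gives the steady state (`add_le_of_affine_recursion`). There the
forcing is `O(μ²)` while `det (I - Γ)` is at least a multiple of `μ`; the quotient is `O(μ)`. -/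

/-! ### Spectral radii of real matrices -/

section SpectralRadius

variable {n : Type*} [Fintype n] [DecidableEq n]

theorem specRad_le {B : Matrix n n ℝ} {r : ℝ} (hr : 0 ≤ r)
    (h : ∀ z ∈ spectrum ℂ (B.map (fun t : ℝ => (t : ℂ))), ‖z‖ ≤ r) : specRad B ≤ r := by
  refine ENNReal.toReal_le_of_le_ofReal hr (iSup₂_le fun z hz => ?_)
  rw [← enorm_eq_nnnorm, ← ofReal_norm]
  exact ENNReal.ofReal_le_ofReal (h z hz)

theorem norm_le_specRad {B : Matrix n n ℝ} {z : ℂ}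
    (hz : z ∈ spectrum ℂ (B.map (fun t : ℝ => (t : ℂ)))) : ‖z‖ ≤ specRad B := by
  -- `toReal` sends `∞` to `0`, so the supremum must first be shown finite.
  have hfin := Matrix.finite_spectrum (B.map (fun t : ℝ => (t : ℂ)))
  obtain ⟨r, hr⟩ := (hfin.image norm).bddAbove
  have hle : spectralRadius ℂ (B.map (fun t : ℝ => (t : ℂ))) ≤ ENNReal.ofReal r := by
    refine iSup₂_le fun y hy => ?_
    rw [← enorm_eq_nnnorm, ← ofReal_norm]
    exact ENNReal.ofReal_le_ofReal (hr ⟨y, hy, rfl⟩)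
  have hne := ne_top_of_le_ne_top ENNReal.ofReal_ne_top hle
  have h1 : (‖z‖₊ : ℝ≥0∞) ≤ spectralRadius ℂ (B.map (fun t : ℝ => (t : ℂ))) :=
    le_iSup₂ (f := fun (k : ℂ) (_ : k ∈ spectrum ℂ (B.map (fun t : ℝ => (t : ℂ)))) =>
      (‖k‖₊ : ℝ≥0∞)) z hz
  simpa [specRad] using ENNReal.toReal_mono hne h1

theorem spectrum_map_of_isDiag {J : Matrix n n ℝ} (hJ : J.IsDiag) :
    spectrum ℂ (J.map (fun t : ℝ => (t : ℂ))) = Set.range fun j => ((J j j : ℝ) : ℂ) := by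
  rw [← spectrum_diagonal (n := n) (R := ℂ)]
  congr 1
  conv_lhs => rw [← hJ.diagonal_diag]
  rw [Matrix.diagonal_map (by simp)]
  rfl

theorem abs_diag_le_specRad {J : Matrix n n ℝ} (hJ : J.IsDiag) (j : n) :
    |J j j| ≤ specRad J := by
  have := norm_le_specRad (B := J) (z := ((J j j : ℝ) : ℂ))
    (by rw [spectrum_map_of_isDiag hJ]; exact ⟨j, rfl⟩)
  simpa using this

theorem specRad_lt_one_of_isDiag {J : Matrix n n ℝ} (hJ : J.IsDiag) (h : ∀ j, |J j j| < 1) :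
    specRad J < 1 := by
  obtain ⟨r, hr0, hr1, hr⟩ : ∃ r : ℝ, 0 ≤ r ∧ r < 1 ∧ ∀ j, |J j j| ≤ r := by
    rcases isEmpty_or_nonempty n with hn | hn
    · exact ⟨0, le_rfl, one_pos, fun j => hn.elim j⟩
    · obtain ⟨j, hj⟩ := Finite.exists_max fun j => |J j j|
      exact ⟨_, abs_nonneg _, h j, hj⟩
  refine (specRad_le hr0 fun z hz => ?_).trans_lt hr1
  rw [spectrum_map_of_isDiag hJ] at hz
  obtain ⟨j, rfl⟩ := hz
  simpa using hr j

theorem specRad_nonneg (B : Matrix n n ℝ) : 0 ≤ specRad B := ENNReal.toReal_nonneg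

end SpectralRadius

/-! ### The eigendecomposition of a combination matrix -/

/-- A symmetric matrix fixing `𝟙` preserves the orthogonal complement of `𝟙`, and the spectral
theorem applies to the restriction. Primitivity plays no role here. -/
theorem exists_isEigendecomposition {K : ℕ} [NeZero K] {A : Matrix (Fin K) (Fin K) ℝ}
    (hs : A.IsSymm) (hA : A ∈ doublyStochastic ℝ (Fin K)) :
    ∃ (VR : Matrix (Fin K) (Fin (K - 1)) ℝ) (J : Matrix (Fin (K - 1)) (Fin (K - 1)) ℝ),
      IsEigendecomposition A VR J := by
  have hK : (K : ℝ) ≠ 0 := Nat.cast_ne_zero.mpr (NeZero.ne K)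
  set T : EuclideanSpace ℝ (Fin K) →ₗ[ℝ] EuclideanSpace ℝ (Fin K) := Matrix.toEuclideanLin A
    with hT_def
  have hT : T.IsSymmetric := Matrix.isSymmetric_toEuclideanLin_iff.mpr (by
    rw [Matrix.IsHermitian, Matrix.conjTranspose_eq_transpose_of_trivial]; exact hs)
  set e : EuclideanSpace ℝ (Fin K) := WithLp.toLp 2 (fun _ => 1) with he
  have hTe : T e = e := by
    ext i
    simp [hT_def, he, Matrix.toEuclideanLin, Matrix.mulVec, dotProduct,
      sum_row_of_mem_doublyStochastic hA]
  have hinner : ∀ x : EuclideanSpace ℝ (Fin K), ⟪e, x⟫ = ∑ i, x i := fun x => by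
    simp [he, PiLp.inner_apply]
  have he0 : e ≠ 0 := fun h => by
    have := congrArg (fun x : EuclideanSpace ℝ (Fin K) => x ⟨0, NeZero.pos K⟩) h
    simp [he] at this
  set V : Submodule ℝ (EuclideanSpace ℝ (Fin K)) := (ℝ ∙ e)ᗮ with hV
  have hmem : ∀ x, x ∈ V ↔ ∑ i, x i = 0 := fun x => by
    rw [hV, Submodule.mem_orthogonal_singleton_iff_inner_right, hinner]
  have hn : Module.finrank ℝ V = K - 1 := by
    have h1 := Submodule.finrank_add_finrank_orthogonal (ℝ ∙ e)
    rw [finrank_span_singleton he0, finrank_euclideanSpace_fin, ← hV] at h1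
    omega
  have hinv : ∀ v ∈ V, T v ∈ V := fun v hv => by
    rw [hV, Submodule.mem_orthogonal_singleton_iff_inner_right] at hv ⊢
    rw [← hT, hTe, hv]
  have hTV : (T.restrict hinv).IsSymmetric := hT.restrict_invariant hinv
  set b := hTV.eigenvectorBasis hn with hb
  set VR : Matrix (Fin K) (Fin (K - 1)) ℝ := Matrix.of fun k j => (b j : EuclideanSpace ℝ (Fin K)) k
    with hVR
  set J : Matrix (Fin (K - 1)) (Fin (K - 1)) ℝ := Matrix.diagonal (hTV.eigenvalues hn) with hJ
  have hAV : A * VR = VR * J := by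
    ext k j
    have h1 := congrArg (fun x : V => (x : EuclideanSpace ℝ (Fin K)) k)
      (hTV.apply_eigenvectorBasis hn j)
    simp only [LinearMap.coe_restrict_apply, Submodule.coe_smul, PiLp.smul_apply] at h1
    rw [hJ, Matrix.mul_diagonal]
    simpa [hT_def, Matrix.toEuclideanLin, Matrix.mulVec, dotProduct, Matrix.mul_apply, hVR, hb,
      mul_comm] using h1
  -- Completeness of the basis: the projection of the l-th unit vector to the complement of `𝟙` is
  -- expanded in the eigenvectors.
  have hVV : Matrix.of (fun _ _ => (K : ℝ)⁻¹) + VR * VRᵀ = 1 := by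
    ext k l
    set y : EuclideanSpace ℝ (Fin K) := EuclideanSpace.single l 1 - (K : ℝ)⁻¹ • e with hy
    have hyV : y ∈ V := by
      rw [hmem]
      simp [hy, he, hK, Finset.sum_sub_distrib]
    have h1 := congrArg (fun x : V => (x : EuclideanSpace ℝ (Fin K)) k) (b.sum_repr' ⟨y, hyV⟩)
    have h2 : ∀ j, ⟪b j, (⟨y, hyV⟩ : V)⟫ = (b j : EuclideanSpace ℝ (Fin K)) l := fun j => by
      have h3 : ⟪(b j : EuclideanSpace ℝ (Fin K)), e⟫ = 0 := by
        rw [real_inner_comm, hinner, (hmem _).mp (b j).2]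
      change ⟪(b j : EuclideanSpace ℝ (Fin K)), y⟫ = _
      rw [hy, inner_sub_right, inner_smul_right, h3, EuclideanSpace.inner_single_right]
      simp
    simp only [h2, Submodule.coe_sum, Submodule.coe_smul, WithLp.ofLp_sum, Finset.sum_apply,
      PiLp.smul_apply] at h1
    simp only [Matrix.add_apply, Matrix.of_apply, Matrix.mul_apply, Matrix.transpose_apply, hVR]
    rw [Finset.sum_congr rfl fun j _ => mul_comm _ _]
    simp only [smul_eq_mul] at h1
    rw [h1]
    simp [hy, he, Matrix.one_apply]
  refine ⟨VR, J, Matrix.isDiag_diagonal _, ?_, fun j => (hmem _).mp (b j).2, ?_⟩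
  · ext i j
    have h1 := orthonormal_iff_ite.mp b.orthonormal i j
    rw [Submodule.coe_inner, PiLp.inner_apply] at h1
    rw [Matrix.one_apply, ← h1, Matrix.mul_apply]
    refine Finset.sum_congr rfl fun k _ => ?_
    simp only [hVR, Matrix.transpose_apply, Matrix.of_apply, RCLike.inner_apply, conj_trivial]
    exact mul_comm _ _
  · have h1 : A * Matrix.of (fun _ _ => (K : ℝ)⁻¹) = Matrix.of (fun _ _ => (K : ℝ)⁻¹) := by
      ext i j
      simp [Matrix.mul_apply, ← Finset.sum_mul, sum_row_of_mem_doublyStochastic hA]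
    calc A = A * (Matrix.of (fun _ _ => (K : ℝ)⁻¹) + VR * VRᵀ) := by rw [hVV, mul_one]
      _ = _ := by rw [mul_add, h1, ← Matrix.mul_assoc, hAV]

namespace IsEigendecomposition

variable {K : ℕ} {A : Matrix (Fin K) (Fin K) ℝ} {VR : Matrix (Fin K) (Fin (K - 1)) ℝ}
  {J : Matrix (Fin (K - 1)) (Fin (K - 1)) ℝ}

theorem mul_eq (h : IsEigendecomposition A VR J) : A * VR = VR * J := by
  have h1 : (Matrix.of (fun _ _ => (K : ℝ)⁻¹) : Matrix (Fin K) (Fin K) ℝ) * VR = 0 := by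
    ext i j
    simp [Matrix.mul_apply, ← Finset.mul_sum, h.orthogonal_one j]
  conv_lhs => rw [h.eq]
  rw [Matrix.add_mul, h1, zero_add, Matrix.mul_assoc, h.orthonormal, Matrix.mul_one]

theorem sum_mul_eq (h : IsEigendecomposition A VR J)
    (m : Fin K) (j : Fin (K - 1)) : ∑ k, A m k * VR k j = J j j * VR m j := by
  have h1 := congrFun (congrFun h.mul_eq m) j
  rw [Matrix.mul_apply, ← h.isDiag.diagonal_diag, Matrix.mul_diagonal] at h1
  rw [h1, Matrix.diag_apply, mul_comm]

/-- Adjoining the column `K^{-1/2} 𝟙` to `V_R` gives a square matrix with orthonormal columns; its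
rows are then orthonormal too. -/
theorem one_add_mul_transpose [NeZero K] (h : IsEigendecomposition A VR J) :
    Matrix.of (fun _ _ => (K : ℝ)⁻¹) + VR * VRᵀ = 1 := by
  have hK : (0 : ℝ) < K := Nat.cast_pos.mpr (NeZero.pos K)
  set U : Matrix (Fin K) (Unit ⊕ Fin (K - 1)) ℝ :=
    Matrix.fromCols (Matrix.of fun _ _ => (√K)⁻¹) VR with hU
  have h1 : Uᵀ * U = 1 := by
    rw [hU, Matrix.transpose_fromCols, Matrix.fromRows_mul_fromCols, h.orthonormal,
      ← Matrix.fromBlocks_one]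
    congr 1
    · ext i j
      simp only [Matrix.mul_apply, Matrix.transpose_apply, Matrix.of_apply, Finset.sum_const,
        Finset.card_univ, Fintype.card_fin, nsmul_eq_mul, Matrix.one_apply_eq]
      rw [← mul_inv, Real.mul_self_sqrt hK.le, mul_inv_cancel₀ hK.ne']
    · ext i j
      simp [Matrix.mul_apply, ← Finset.mul_sum, h.orthogonal_one]
    · ext i j
      simp [Matrix.mul_apply, ← Finset.sum_mul, h.orthogonal_one]
  have hcard : Fintype.card (Unit ⊕ Fin (K - 1)) = Fintype.card (Fin K) := by
    have := NeZero.pos K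
    simp; omega
  have h2 : U * Uᵀ = 1 := (Matrix.mul_eq_one_comm_of_card_eq _ _ _ hcard).mp h1
  rw [← h2, hU, Matrix.transpose_fromCols, Matrix.fromCols_mul_fromRows]
  congr 1
  ext i j
  simp [Matrix.mul_apply, ← mul_inv, Real.mul_self_sqrt hK.le]

/-- A maximum principle: a positive power of `A` averages with strictly positive weights, and an
eigenvector orthogonal to `𝟙` is not constant, so averaging strictly lowers its largest modulus.
This is where primitivity is used. -/
theorem abs_diag_lt_one (h : IsEigendecomposition A VR J)
    (hA : IsCombinationMatrix A) (j : Fin (K - 1)) : |J j j| < 1 := by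
  obtain ⟨n, hn, hpos⟩ := hA.primitive.exists_pos_pow
  set B := A ^ n with hB
  have hBs : B ∈ doublyStochastic ℝ (Fin K) := pow_mem hA.stochastic n
  set v : Fin K → ℝ := fun k => VR k j with hv
  have hAv : A *ᵥ v = J j j • v := by
    ext m
    exact h.sum_mul_eq m j
  have hpow : ∀ i : ℕ, (A ^ i) *ᵥ v = J j j ^ i • v := by
    intro i
    induction i with
    | zero => simp
    | succ i ih => rw [pow_succ, ← Matrix.mulVec_mulVec, hAv, Matrix.mulVec_smul, ih, smul_smul,
        pow_succ, mul_comm]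
  have hsum : ∑ k, v k = 0 := h.orthogonal_one j
  have hnorm : ∑ k, v k * v k = 1 := by
    have := congrFun (congrFun h.orthonormal j) j
    simpa [Matrix.mul_apply] using this
  have hne : Nonempty (Fin K) := ⟨⟨0, by have := j.2; omega⟩⟩
  obtain ⟨k, hk⟩ := Finite.exists_max fun k => |v k|
  have hX : 0 < |v k| := by
    by_contra hcon
    have : ∀ m, v m = 0 := fun m => abs_nonpos_iff.mp ((hk m).trans (not_lt.mp hcon))
    simp [this] at hnorm
  -- Applied to `v` and to `-v`. A vector of sum zero lies strictly below `|v k| > 0` at some entry,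
  -- and every entry of `B` is positive.
  have key : ∀ u : Fin K → ℝ, ∑ m, u m = 0 → (∀ m, u m ≤ |v k|) → ∑ m, B k m * u m < |v k| := by
    intro u hu hle
    obtain ⟨m, hm⟩ : ∃ m, u m < |v k| := by
      by_contra! hcon
      have := Finset.sum_le_sum fun m (_ : m ∈ Finset.univ) => hcon m
      rw [hu, Finset.sum_const, nsmul_eq_mul] at this
      have h3 : (0 : ℝ) < (Finset.univ : Finset (Fin K)).card := by
        exact_mod_cast Finset.card_pos.mpr Finset.univ_nonempty
      nlinarith
    calc ∑ m, B k m * u m < ∑ m, B k m * |v k| :=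
          Finset.sum_lt_sum (fun i _ => mul_le_mul_of_nonneg_left (hle i) (hpos k i).le)
            ⟨m, Finset.mem_univ _, mul_lt_mul_of_pos_left hm (hpos k m)⟩
      _ = |v k| := by rw [← Finset.sum_mul, sum_row_of_mem_doublyStochastic hBs, one_mul]
  have h1 := key v hsum fun m => (le_abs_self _).trans (hk m)
  have h2 := key (fun m => -v m) (by simp [hsum]) fun m => (neg_le_abs _).trans (hk m)
  have h3 : ∑ m, B k m * v m = J j j ^ n * v k := congrFun (hpow n) k
  have h4 : |J j j ^ n * v k| < |v k| := by
    rw [abs_lt, ← h3]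
    simp only [mul_neg, Finset.sum_neg_distrib] at h2
    exact ⟨by linarith, h1⟩
  rw [abs_mul, abs_pow] at h4
  exact (pow_lt_one_iff_of_nonneg (abs_nonneg _) hn.ne').mp (by nlinarith)

/-- Parseval's identity for the orthonormal basis formed by `K^{-1/2} 𝟙` and the columns of
`V_R`. -/
theorem sum_norm_sq [NeZero K] {E : Type*} [NormedAddCommGroup E] [InnerProductSpace ℝ E]
    (h : IsEigendecomposition A VR J) (x : Fin K → E) :
    ∑ k, ‖x k‖ ^ 2 = (K : ℝ)⁻¹ * ‖∑ k, x k‖ ^ 2 + ∑ j, ‖∑ k, VR k j • x k‖ ^ 2 := by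
  have h1 : ∀ k l, (K : ℝ)⁻¹ + ∑ j, VR k j * VR l j = if k = l then 1 else 0 := fun k l => by
    have := congrFun (congrFun h.one_add_mul_transpose k) l
    simpa [Matrix.mul_apply, Matrix.one_apply] using this
  have h2 : ∀ j, ‖∑ k, VR k j • x k‖ ^ 2 = ∑ k, ∑ l, VR k j * VR l j * ⟪x k, x l⟫ := fun j => by
    rw [← real_inner_self_eq_norm_sq, sum_inner]
    simp [inner_sum, inner_smul_left, inner_smul_right, mul_assoc]
    simp only [mul_left_comm]
  have h3 : ‖∑ k, x k‖ ^ 2 = ∑ k, ∑ l, ⟪x k, x l⟫ := by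
    rw [← real_inner_self_eq_norm_sq, sum_inner]
    simp [inner_sum]
  rw [h3, Finset.sum_congr rfl fun j _ => h2 j,
    Finset.sum_comm (s := (Finset.univ : Finset (Fin (K - 1)))), Finset.mul_sum, ← Finset.sum_add_distrib]
  refine Finset.sum_congr rfl fun k _ => ?_
  rw [Finset.sum_comm, Finset.mul_sum, ← Finset.sum_add_distrib]
  simp only [← Finset.sum_mul, ← add_mul, h1, ite_mul, one_mul, zero_mul, Finset.sum_ite_eq,
    Finset.mem_univ, if_true, real_inner_self_eq_norm_sq]

end IsEigendecomposition

/-! ### Two-dimensional affine recursions -/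

/-- With `b * c ≥ 0` the discriminant is nonnegative, so both eigenvalues are real; with `a + d ≥ 0`
the larger one has the larger modulus. -/
theorem specRad_fin_two {a b c d : ℝ} (hbc : 0 ≤ b * c) (had : 0 ≤ a + d) :
    specRad !![a, b; c, d] = (a + d + √((a - d) ^ 2 + 4 * (b * c))) / 2 := by
  set s := √((a - d) ^ 2 + 4 * (b * c)) with hs
  have hs0 : 0 ≤ s := Real.sqrt_nonneg _
  have hss : s ^ 2 = (a - d) ^ 2 + 4 * (b * c) := Real.sq_sqrt (by positivity)
  have hspec : ∀ z : ℂ, z ∈ spectrum ℂ ((!![a, b; c, d]).map (fun t : ℝ => (t : ℂ))) ↔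
      (z - ((a + d + s) / 2 : ℝ)) * (z - ((a + d - s) / 2 : ℝ)) = 0 := fun z => by
    rw [Matrix.mem_spectrum_iff_isRoot_charpoly, Matrix.charpoly_fin_two, Polynomial.IsRoot]
    have hC : (s : ℂ) ^ 2 = ((a : ℂ) - d) ^ 2 + 4 * (b * c) := by exact_mod_cast hss
    have : Polynomial.eval z (Polynomial.X ^ 2
        - Polynomial.C ((!![a, b; c, d]).map (fun t : ℝ => (t : ℂ))).trace * Polynomial.X
        + Polynomial.C ((!![a, b; c, d]).map (fun t : ℝ => (t : ℂ))).det)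
        = (z - ((a + d + s) / 2 : ℝ)) * (z - ((a + d - s) / 2 : ℝ)) := by
      simp [Matrix.trace_fin_two, Matrix.det_fin_two]
      linear_combination (1 / 4 : ℂ) * hC
    rw [this]
  refine le_antisymm (specRad_le (by positivity) fun z hz => ?_) ?_
  · rcases mul_eq_zero.mp ((hspec z).mp hz) with h | h
    · rw [sub_eq_zero.mp h, Complex.norm_real, Real.norm_eq_abs, abs_of_nonneg (by positivity)]
    · rw [sub_eq_zero.mp h, Complex.norm_real, Real.norm_eq_abs, abs_le]
      constructor <;> linarith
  · have h := norm_le_specRad ((hspec ((a + d + s) / 2 : ℝ)).mpr (by simp))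
    rwa [Complex.norm_real, Real.norm_eq_abs, abs_of_nonneg (by positivity)] at h

theorem specRad_fin_two_lt_one {a b c d : ℝ} (hbc : 0 ≤ b * c) (had : 0 ≤ a + d) (ha : a ≤ 1)
    (hd : d < 1) (hdet : 0 < (1 - a) * (1 - d) - b * c) : specRad !![a, b; c, d] < 1 := by
  rw [specRad_fin_two hbc had]
  have : √((a - d) ^ 2 + 4 * (b * c)) < 2 - (a + d) := by
    rw [Real.sqrt_lt' (by linarith)]
    nlinarith
  linarith

/-- Bounds the closed form of a power of a two-by-two matrix with eigenvalues `r`, `r'`, where `t`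
stands for their difference. -/
theorem pow_combination_le {r r' z w t η : ℝ} (hr0 : 0 ≤ r) (hr1 : r ≤ 1) (hr' : |r'| ≤ r)
    (hz : 0 ≤ z) (hw : 0 ≤ w) (hη : 0 < η) (ht : η ≤ t) (i : ℕ) :
    (r ^ i * (z - r' * w) - r' ^ i * (z - r * w)) / t ≤ 2 * (z + w) / η * r ^ i := by
  have hpow : |r' ^ i| ≤ r ^ i := by
    rw [abs_pow]; exact pow_le_pow_left₀ (abs_nonneg _) hr' i
  have h0 : -r' * w ≤ 1 * w :=
    mul_le_mul_of_nonneg_right ((neg_le_abs _).trans (hr'.trans hr1)) hw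
  have h0' : r * w ≤ 1 * w := mul_le_mul_of_nonneg_right hr1 hw
  have h0'' : 0 ≤ r * w := mul_nonneg hr0 hw
  have h1 : r ^ i * (z - r' * w) ≤ r ^ i * (z + w) :=
    mul_le_mul_of_nonneg_left (by linarith) (pow_nonneg hr0 i)
  have h2 : -(r' ^ i * (z - r * w)) ≤ r ^ i * (z + w) := by
    refine (neg_le_abs _).trans ?_
    rw [abs_mul]
    exact mul_le_mul hpow (abs_le.mpr ⟨by linarith, by linarith⟩) (abs_nonneg _) (pow_nonneg hr0 i)
  calc _ ≤ (2 * (z + w) * r ^ i) / t := div_le_div_of_nonneg_right (by linarith) (hη.le.trans ht)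
    _ ≤ (2 * (z + w) * r ^ i) / η :=
        div_le_div_of_nonneg_left (mul_nonneg (by linarith) (pow_nonneg hr0 i)) hη ht
    _ = _ := by ring

/-- A nonnegative affine recursion in dimension two whose matrix has its two real eigenvalues
at distance at least `η` converges at the rate of the spectral radius, with a constant that
depends only on `η` and the column sums. -/
theorem add_le_of_affine_recursion {a b c d p q s η : ℝ} {x y : ℕ → ℝ}
    (ha : 0 ≤ a) (hb : 0 ≤ b) (hc : 0 ≤ c) (hd : 0 ≤ d) (ha1 : a ≤ 1) (hd1 : d < 1)
    (hdet : 0 < (1 - a) * (1 - d) - b * c) (hη : 0 < η) (had : η ≤ a - d)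
    (hac : a + c ≤ s) (hbd : b + d ≤ s) (hp : 0 ≤ p) (hq : 0 ≤ q)
    (hx0 : 0 ≤ x 0) (hy0 : 0 ≤ y 0)
    (hx : ∀ i, x (i + 1) ≤ a * x i + b * y i + p) (hy : ∀ i, y (i + 1) ≤ c * x i + d * y i + q)
    (i : ℕ) :
    x i + y i ≤ 2 * (s + 1) / η * specRad !![a, b; c, d] ^ i * (x 0 + y 0)
      + ((1 - d + c) * p + (b + 1 - a) * q) / ((1 - a) * (1 - d) - b * c) := by
  have hbc : 0 ≤ b * c := mul_nonneg hb hc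
  have hr1 := specRad_fin_two_lt_one hbc (add_nonneg ha hd) ha1 hd1 hdet
  rw [specRad_fin_two hbc (add_nonneg ha hd)] at hr1 ⊢
  set t := √((a - d) ^ 2 + 4 * (b * c)) with ht
  have htt : t ^ 2 = (a - d) ^ 2 + 4 * (b * c) := Real.sq_sqrt (by positivity)
  -- `t` is the gap between the eigenvalues and the denominator of the closed form; it must not
  -- degenerate as the step size shrinks.
  have hηt : η ≤ t := had.trans (Real.le_sqrt_of_sq_le (by linarith))
  have ht0 : 0 < t := hη.trans_le hηt
  set r := (a + d + t) / 2 with hr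
  set r' := (a + d - t) / 2 with hr'
  have hr0 : 0 ≤ r := by positivity
  have habs : |r'| ≤ r := abs_le.mpr ⟨by linarith, by linarith⟩
  have hsum : r + r' = a + d := by rw [hr, hr']; ring
  have hprod : r * r' = a * d - b * c := by
    rw [hr, hr']; linear_combination (-1 / 4 : ℝ) * htt
  have hsub : r - r' = t := by rw [hr, hr']; ring
  set D := (1 - a) * (1 - d) - b * c with hD
  set z₁ := a * x 0 + b * y 0 with hz₁
  set z₂ := c * x 0 + d * y 0 with hz₂
  have hz₁0 : 0 ≤ z₁ := by positivity
  have hz₂0 : 0 ≤ z₂ := by positivity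
  -- `(X i, Y i)` is the i-th power of the matrix applied to `(x 0, y 0)`, obtained by interpolating
  -- at the two eigenvalues; `(z₁, z₂)` is the first iterate.
  set X : ℕ → ℝ := fun i => (r ^ i * (z₁ - r' * x 0) - r' ^ i * (z₁ - r * x 0)) / t with hX
  set Y : ℕ → ℝ := fun i => (r ^ i * (z₂ - r' * y 0) - r' ^ i * (z₂ - r * y 0)) / t with hY
  have hXs : ∀ i, X (i + 1) = a * X i + b * Y i := fun i => by
    simp only [hX, hY, pow_succ]
    field_simp
    rw [hz₁, hz₂]
    linear_combination (r ^ i * (a * x 0 + b * y 0) - r' ^ i * (a * x 0 + b * y 0)) * hsum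
      - (r ^ i - r' ^ i) * x 0 * hprod
  have hYs : ∀ i, Y (i + 1) = c * X i + d * Y i := fun i => by
    simp only [hX, hY, pow_succ]
    field_simp
    rw [hz₁, hz₂]
    linear_combination (r ^ i * (c * x 0 + d * y 0) - r' ^ i * (c * x 0 + d * y 0)) * hsum
      - (r ^ i - r' ^ i) * y 0 * hprod
  -- The fixed point `(I - Γ)⁻¹ (p, q)`, by Cramer's rule. Nonnegative entries of the matrix let the
  -- comparison with `(X + u, Y + v)` pass through the induction.
  set u := ((1 - d) * p + b * q) / D with hu
  set v := (c * p + (1 - a) * q) / D with hv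
  have hu0 : 0 ≤ u := by
    have : 0 ≤ 1 - d := by linarith
    positivity
  have hv0 : 0 ≤ v := by
    have : 0 ≤ 1 - a := by linarith
    positivity
  have hus : a * u + b * v + p = u := by
    rw [hu, hv]; field_simp; rw [hD]; ring
  have hvs : c * u + d * v + q = v := by
    rw [hu, hv]; field_simp; rw [hD]; ring
  have hX0 : X 0 = x 0 := by
    simp only [hX, pow_zero, one_mul]
    rw [div_eq_iff ht0.ne', ← hsub]; ring
  have hY0 : Y 0 = y 0 := by
    simp only [hY, pow_zero, one_mul]
    rw [div_eq_iff ht0.ne', ← hsub]; ring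
  have hle : ∀ i, x i ≤ X i + u ∧ y i ≤ Y i + v := by
    intro i
    induction i with
    | zero => rw [hX0, hY0]; exact ⟨by linarith, by linarith⟩
    | succ i ih =>
      obtain ⟨h1, h2⟩ := ih
      constructor
      · calc x (i + 1) ≤ a * x i + b * y i + p := hx i
          _ ≤ a * (X i + u) + b * (Y i + v) + p := by gcongr
          _ = X (i + 1) + u := by rw [hXs]; linear_combination hus
      · calc y (i + 1) ≤ c * x i + d * y i + q := hy i
          _ ≤ c * (X i + u) + d * (Y i + v) + q := by gcongr
          _ = Y (i + 1) + v := by rw [hYs]; linear_combination hvs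
  obtain ⟨h1, h2⟩ := hle i
  have h3 : z₁ + z₂ ≤ s * (x 0 + y 0) := by
    rw [hz₁, hz₂]
    linarith [mul_le_mul_of_nonneg_right hac hx0, mul_le_mul_of_nonneg_right hbd hy0]
  have h4 : u + v = ((1 - d + c) * p + (b + 1 - a) * q) / D := by
    rw [hu, hv, ← add_div]; ring
  calc x i + y i ≤ (X i + Y i) + (u + v) := by linarith
    _ ≤ (2 * (z₁ + x 0) / η * r ^ i + 2 * (z₂ + y 0) / η * r ^ i) + (u + v) := by
        gcongr
        · exact pow_combination_le hr0 hr1.le habs hz₁0 hx0 hη hηt i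
        · exact pow_combination_le hr0 hr1.le habs hz₂0 hy0 hη hηt i
    _ = 2 * (z₁ + z₂ + (x 0 + y 0)) / η * r ^ i + (u + v) := by ring
    _ ≤ 2 * (s * (x 0 + y 0) + (x 0 + y 0)) / η * r ^ i + (u + v) := by gcongr
    _ = _ := by rw [h4]; ring

theorem mseBound_one {a b c d τ μ σs2 bsq : ℝ} (hdet : (1 - a) * (1 - d) - b * c ≠ 0) :
    mseBound 1 1 !![a, b; c, d] τ μ σs2 bsq =
      ((1 - d + c) * (μ ^ 2 * σs2) + (b + 1 - a) * (μ ^ 2 * σs2 + 3 * bsq / (1 - τ)))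
        / ((1 - a) * (1 - d) - b * c) := by
  have h1 : (1 : Matrix (Fin 2) (Fin 2) ℝ) - !![a, b; c, d] = !![1 - a, -b; -c, 1 - d] := by
    ext i j; fin_cases i <;> fin_cases j <;> simp
  have h2 : (!![1 - a, -b; -c, 1 - d] : Matrix (Fin 2) (Fin 2) ℝ).det
      = (1 - a) * (1 - d) - b * c := by
    rw [Matrix.det_fin_two_of]; ring
  rw [mseBound, h1, Matrix.inv_def, h2, Matrix.adjugate_fin_two_of, Ring.inverse_eq_inv']
  simp only [smul_eq_mul, Matrix.mulVec, dotProduct, Fin.sum_univ_two, Matrix.of_apply,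
    Matrix.cons_val_zero, Matrix.cons_val_one, Pi.one_apply, Matrix.smul_apply]
  field_simp
  ring

/-- The entries of the rate matrix for small step sizes. -/
theorem exists_stepSize_bound {c₁ c₂ c₃ c₄ c₅ τ : ℝ} (hc₁ : 0 < c₁) (hτ : τ < 1) :
    ∃ μ₀ : ℝ, 0 < μ₀ ∧ ∀ μ, 0 < μ → μ ≤ μ₀ → μ ≤ 1 ∧ 0 ≤ 1 - c₁ * μ + c₂ * μ ^ 2 ∧
      1 - c₁ * μ + c₂ * μ ^ 2 ≤ 1 ∧ √τ + c₅ * μ ^ 2 < 1 ∧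
      (1 - √τ) / 2 ≤ (1 - c₁ * μ + c₂ * μ ^ 2) - (√τ + c₅ * μ ^ 2) ∧
      c₁ * (1 - √τ) / 8 * μ ≤ (1 - (1 - c₁ * μ + c₂ * μ ^ 2)) * (1 - (√τ + c₅ * μ ^ 2))
        - c₃ * √μ * (c₄ * μ) := by
  have hs : √τ < 1 := by rw [Real.sqrt_lt' one_pos]; simpa using hτ
  -- Each requirement, divided by a power of `μ` where necessary, is a strict inequality that holds
  -- at `0` and persists nearby by continuity.
  have hcont : ∀ f : ℝ → ℝ, Continuous f → ∀ t, f 0 < t → ∀ᶠ μ in nhdsWithin 0 (Set.Ioi 0), f μ < t :=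
    fun f hf t ht => (hf.tendsto 0).mono_left nhdsWithin_le_nhds |>.eventually_lt_const ht
  have e0 := hcont (fun μ => μ) (by fun_prop) 1 one_pos
  have e1 := hcont (fun μ => c₁ * μ - c₂ * μ ^ 2) (by fun_prop) 1 (by simp)
  have e2 := hcont (fun μ => c₂ * μ) (by fun_prop) (c₁ / 2) (by simpa using hc₁)
  have e3 := hcont (fun μ => c₅ * μ ^ 2) (by fun_prop) ((1 - √τ) / 2) (by simpa using hs)
  have e4 := hcont (fun μ => √τ + c₅ * μ ^ 2 + c₁ * μ - c₂ * μ ^ 2) (by fun_prop)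
    (1 - (1 - √τ) / 2) (by simp; linarith)
  have e5 := hcont (fun μ => c₃ * c₄ * √μ) (by fun_prop) (c₁ * (1 - √τ) / 8)
    (by simp only [Real.sqrt_zero, mul_zero]; have := sub_pos.mpr hs; positivity)
  obtain ⟨μ₀, hμ₀, h⟩ := mem_nhdsGT_iff_exists_Ioc_subset.mp
    (e0.and (e1.and (e2.and (e3.and (e4.and e5)))))
  refine ⟨μ₀, hμ₀, fun μ hμ hμ' => ?_⟩
  obtain ⟨h0, h1, h2, h3, h4, h5⟩ := h ⟨hμ, hμ'⟩
  have h6 : c₁ / 2 * μ ≤ c₁ * μ - c₂ * μ ^ 2 := by nlinarith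
  have h7 : c₁ * (1 - √τ) / 4 * μ ≤ (c₁ * μ - c₂ * μ ^ 2) * (1 - (√τ + c₅ * μ ^ 2)) :=
    calc c₁ * (1 - √τ) / 4 * μ = (c₁ / 2 * μ) * ((1 - √τ) / 2) := by ring
      _ ≤ _ := mul_le_mul h6 (by linarith) (by linarith) (le_trans (by positivity) h6)
  -- The off-diagonal product is of order `μ^{3/2}`; it takes at most half of the diagonal product
  -- bounded in `h7`, hence the `8`.
  have h8 : c₃ * √μ * (c₄ * μ) ≤ c₁ * (1 - √τ) / 8 * μ := by nlinarith
  have h9 : 0 ≤ c₁ / 2 * μ := by positivity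
  exact ⟨h0.le, by linarith, by linarith, by linarith, by linarith, by linarith⟩

/-! ### Inequalities in inner product spaces -/

section InnerProduct

variable {E : Type*} [NormedAddCommGroup E]

/-- The free weight matters: `μν` for the centroid and `(1 - τ) / τ` for the disagreement keep the
contraction factors below one. -/
theorem norm_add_sq_le_weighted (u v : E) {s : ℝ} (hs : 0 < s) :
    ‖u + v‖ ^ 2 ≤ (1 + s) * ‖u‖ ^ 2 + (1 + s⁻¹) * ‖v‖ ^ 2 := by
  have h1 : ‖u + v‖ ^ 2 ≤ (‖u‖ + ‖v‖) ^ 2 := pow_le_pow_left₀ (norm_nonneg _) (norm_add_le u v) 2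
  have h2 : 0 ≤ s⁻¹ * (s * ‖u‖ - ‖v‖) ^ 2 := by positivity
  have h3 : s⁻¹ * (s * ‖u‖ - ‖v‖) ^ 2 = s * ‖u‖ ^ 2 - 2 * ‖u‖ * ‖v‖ + s⁻¹ * ‖v‖ ^ 2 := by
    field_simp
    ring
  nlinarith

theorem inv_card_mul_norm_sum_sq_le {K : ℕ} (x : Fin K → E) :
    (K : ℝ)⁻¹ * ‖∑ k, x k‖ ^ 2 ≤ ∑ k, ‖x k‖ ^ 2 := by
  rcases K.eq_zero_or_pos with rfl | hK
  · simp
  have h1 : ‖∑ k, x k‖ ^ 2 ≤ K * ∑ k, ‖x k‖ ^ 2 :=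
    calc ‖∑ k, x k‖ ^ 2 ≤ (∑ k, ‖x k‖) ^ 2 :=
          pow_le_pow_left₀ (norm_nonneg _) (norm_sum_le _ _) 2
      _ ≤ _ := by simpa using sq_sum_le_card_mul_sum_sq (s := Finset.univ) (f := fun k => ‖x k‖)
  rw [inv_mul_le_iff₀ (by exact_mod_cast hK)]
  exact h1

/-- Centring costs nothing in mean square, which keeps the relative noise factor at `2δ²`. -/
theorem sum_norm_sub_mean_sq_le [InnerProductSpace ℝ E] {N : ℕ} (hN : 0 < N) (d : Fin N → E) :
    ∑ n, ‖d n - (N : ℝ)⁻¹ • ∑ n', d n'‖ ^ 2 ≤ ∑ n, ‖d n‖ ^ 2 := by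
  have hN' : (N : ℝ) ≠ 0 := by exact_mod_cast hN.ne'
  set m := (N : ℝ)⁻¹ • ∑ n', d n' with hm
  have h1 : ∑ n, d n = (N : ℝ) • m := by rw [hm, smul_inv_smul₀ hN']
  have h2 : ∑ n, ‖d n - m‖ ^ 2 = ∑ n, ‖d n‖ ^ 2 - N * ‖m‖ ^ 2 := by
    simp only [norm_sub_sq_real, Finset.sum_add_distrib, Finset.sum_sub_distrib, ← Finset.mul_sum,
      ← sum_inner, h1, inner_smul_left, real_inner_self_eq_norm_sq]
    simp
    ring
  rw [h2]
  have : 0 ≤ (N : ℝ) * ‖m‖ ^ 2 := by positivity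
  linarith

end InnerProduct

/-! ### Gradients of the risks -/

namespace LearningProblem

variable {K M : ℕ} {X : Type*} {L : LearningProblem K M X} {ν δ : ℝ}

theorem N_ne_zero (L : LearningProblem K M X) (k : Fin K) : (L.N k : ℝ) ≠ 0 :=
  Nat.cast_ne_zero.mpr (L.N_pos k).ne'

theorem gradient_eq_zero_of_isMinOn {f : Param M → ℝ} {w : Param M} (h : IsMinOn f Set.univ w) :
    ∇ f w = 0 := by
  rw [gradient, (h.isLocalMin Filter.univ_mem).fderiv_eq_zero, map_zero]

namespace ConvexSmooth

theorem hasGradientAt_risk (h : L.ConvexSmooth ν δ) (k : Fin K) (w : Param M) :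
    HasGradientAt (L.risk k) ((L.N k : ℝ)⁻¹ • ∑ n, ∇ (L.sampleLoss k n) w) w := by
  have h1 : HasFDerivAt (L.risk k) ((L.N k : ℝ)⁻¹ • ∑ n, fderiv ℝ (L.sampleLoss k n) w) w :=
    (HasFDerivAt.fun_sum fun n _ => (h.loss_differentiable k n w).hasFDerivAt).const_mul _
  have h2 := h1.hasGradientAt
  simpa [gradient] using h2

theorem gradient_risk (h : L.ConvexSmooth ν δ) (k : Fin K) (w : Param M) :
    ∇ (L.risk k) w = (L.N k : ℝ)⁻¹ • ∑ n, ∇ (L.sampleLoss k n) w :=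
  (h.hasGradientAt_risk k w).gradient

theorem sum_gradient_sub (h : L.ConvexSmooth ν δ) (k : Fin K) (w : Param M) :
    ∑ n, (∇ (L.sampleLoss k n) w - ∇ (L.risk k) w) = 0 := by
  rw [Finset.sum_sub_distrib, h.gradient_risk, Finset.sum_const, Finset.card_univ,
    Fintype.card_fin, ← Nat.cast_smul_eq_nsmul ℝ, smul_inv_smul₀ (L.N_ne_zero k), sub_self]

theorem norm_gradient_risk_sub_le (h : L.ConvexSmooth ν δ) (k : Fin K) (w₁ w₂ : Param M) :
    ‖∇ (L.risk k) w₂ - ∇ (L.risk k) w₁‖ ≤ δ * ‖w₂ - w₁‖ := by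
  have hN : (0 : ℝ) < L.N k := Nat.cast_pos.mpr (L.N_pos k)
  rw [h.gradient_risk, h.gradient_risk, ← smul_sub, ← Finset.sum_sub_distrib, norm_smul,
    Real.norm_of_nonneg (by positivity), inv_mul_le_iff₀ hN]
  refine (norm_sum_le_of_le _ fun n _ => h.loss_lipschitz k n w₁ w₂).trans ?_
  simp

theorem mul_norm_sq_le_inner (h : L.ConvexSmooth ν δ) (k : Fin K) (w₁ w₂ : Param M) :
    ν * ‖w₂ - w₁‖ ^ 2 ≤ ⟪∇ (L.risk k) w₂ - ∇ (L.risk k) w₁, w₂ - w₁⟫ := by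
  have h1 := h.risk_stronglyConvex k w₁ w₂
  have h2 := h.risk_stronglyConvex k w₂ w₁
  rw [← neg_sub w₂ w₁, inner_neg_right, norm_neg] at h2
  rw [inner_sub_left]
  linarith

theorem sum_gradient_risk_eq_zero [NeZero K] (h : L.ConvexSmooth ν δ) {wo : Param M}
    (hwo : IsMinOn L.aggregateRisk Set.univ wo) : ∑ k, ∇ (L.risk k) wo = 0 := by
  have hK : (K : ℝ) ≠ 0 := Nat.cast_ne_zero.mpr (NeZero.ne K)
  have h1 : HasFDerivAt L.aggregateRisk ((K : ℝ)⁻¹ • ∑ k, fderiv ℝ (L.risk k) wo) wo :=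
    (HasFDerivAt.fun_sum fun k _ =>
      (h.hasGradientAt_risk k wo).differentiableAt.hasFDerivAt).const_mul _
  have h2 := h1.hasGradientAt.gradient
  rw [gradient_eq_zero_of_isMinOn hwo] at h2
  have h3 : (K : ℝ)⁻¹ • ∑ k, ∇ (L.risk k) wo = 0 := by simpa [gradient] using h2.symm
  exact (smul_eq_zero.mp h3).resolve_left (inv_ne_zero hK)

/-- The local gradient vanishes at the local minimizer, at distance at most `ξ`. This is the only
way the drift enters. -/
theorem norm_gradient_risk_le (h : L.ConvexSmooth ν δ) (hδ : 0 ≤ δ) {wo : Param M}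
    {wloc : Fin K → Param M} {ξ : ℝ} (hd : L.BoundedDrift wo wloc ξ) (k : Fin K) :
    ‖∇ (L.risk k) wo‖ ≤ δ * ξ := by
  have h1 := h.norm_gradient_risk_sub_le k (wloc k) wo
  rw [gradient_eq_zero_of_isMinOn (hd.local_optimal k), sub_zero] at h1
  exact h1.trans (mul_le_mul_of_nonneg_left (hd.drift k) hδ)

theorem isGradientNoiseBound (h : L.ConvexSmooth ν δ) (wo : Param M) :
    L.IsGradientNoiseBound wo (2 * δ ^ 2) (2 * ∑ k, L.gradientNoiseVariance k wo) := by
  intro w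
  rw [Finset.mul_sum, Finset.mul_sum, ← Finset.sum_add_distrib]
  refine Finset.sum_le_sum fun k _ => ?_
  have hN : (0 : ℝ) < L.N k := Nat.cast_pos.mpr (L.N_pos k)
  set s : Param M → Fin (L.N k) → Param M := fun v n => ∇ (L.sampleLoss k n) v - ∇ (L.risk k) v
    with hs
  set d : Fin (L.N k) → Param M := fun n => ∇ (L.sampleLoss k n) (w k) - ∇ (L.sampleLoss k n) wo
    with hd
  -- The change in gradient noise between the two models is a centred family of gradient increments,
  -- each bounded by the Lipschitz condition.
  have h1 : ∀ n, s (w k) n - s wo n = d n - (L.N k : ℝ)⁻¹ • ∑ n', d n' := fun n => by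
    simp only [hs, hd, h.gradient_risk, Finset.sum_sub_distrib, smul_sub]
    abel
  have h2 : ∑ n, ‖s (w k) n - s wo n‖ ^ 2 ≤ L.N k * (δ ^ 2 * ‖wo - w k‖ ^ 2) := by
    simp only [h1]
    refine (sum_norm_sub_mean_sq_le (L.N_pos k) d).trans ?_
    have : ∀ n ∈ Finset.univ, ‖d n‖ ^ 2 ≤ δ ^ 2 * ‖wo - w k‖ ^ 2 := fun n _ => by
      rw [norm_sub_rev wo, ← mul_pow]
      exact pow_le_pow_left₀ (norm_nonneg _) (h.loss_lipschitz k n wo (w k)) 2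
    simpa using Finset.sum_le_sum this
  have h3 : ∀ n ∈ Finset.univ, ‖s (w k) n‖ ^ 2
      ≤ 2 * ‖s (w k) n - s wo n‖ ^ 2 + 2 * ‖s wo n‖ ^ 2 := fun n _ => by
    have := norm_add_sq_le_weighted (s (w k) n - s wo n) (s wo n) one_pos
    rw [sub_add_cancel] at this
    linarith
  have h4 := Finset.sum_le_sum h3
  rw [Finset.sum_add_distrib, ← Finset.mul_sum, ← Finset.mul_sum] at h4
  rw [gradientNoiseVariance, gradientNoiseVariance, inv_mul_le_iff₀ hN]
  refine h4.trans ?_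
  rw [mul_add]
  refine add_le_add ?_ (le_of_eq ?_)
  · linarith
  · field_simp
    rfl

end ConvexSmooth

end LearningProblem

/-! ### Centroid and disagreement of the network error -/

/-- The squared norm of the component of the network error along the consensus direction. -/
noncomputable def centroidError {K M : ℕ} (wo : Param M) (w : Fin K → Param M) : ℝ :=
  (K : ℝ)⁻¹ * ‖∑ k, (wo - w k)‖ ^ 2

/-- The squared norm of the component of the network error orthogonal to the consensus
direction. -/
noncomputable def disagreement {K M : ℕ} (VR : Matrix (Fin K) (Fin (K - 1)) ℝ) (wo : Param M)
    (w : Fin K → Param M) : ℝ :=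
  ∑ j, ‖∑ k, VR k j • (wo - w k)‖ ^ 2

/-- One step of diffusion from the models `w` along the directions `g`. -/
noncomputable def diffusionStep {K M : ℕ} (A : Matrix (Fin K) (Fin K) ℝ) (μ : ℝ)
    (w g : Fin K → Param M) (k : Fin K) : Param M :=
  ∑ m, A m k • (w m - μ • g m)

section Step

variable {K M : ℕ} {A : Matrix (Fin K) (Fin K) ℝ} {VR : Matrix (Fin K) (Fin (K - 1)) ℝ}
  {J : Matrix (Fin (K - 1)) (Fin (K - 1)) ℝ}

theorem centroidError_nonneg (wo : Param M) (w : Fin K → Param M) : 0 ≤ centroidError wo w := by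
  unfold centroidError; positivity

theorem disagreement_nonneg (wo : Param M) (w : Fin K → Param M) : 0 ≤ disagreement VR wo w := by
  unfold disagreement; positivity

theorem sqError_eq [NeZero K] (hE : IsEigendecomposition A VR J) (wo : Param M)
    (w : Fin K → Param M) : sqError wo w = centroidError wo w + disagreement VR wo w :=
  hE.sum_norm_sq fun k => wo - w k

theorem sub_diffusionStep (hA : A ∈ doublyStochastic ℝ (Fin K)) (μ : ℝ) (wo : Param M)
    (w g : Fin K → Param M) (k : Fin K) :
    wo - diffusionStep A μ w g k = ∑ m, A m k • (wo - w m + μ • g m) := by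
  have h1 : wo = ∑ m, A m k • wo := by
    rw [← Finset.sum_smul, sum_col_of_mem_doublyStochastic hA, one_smul]
  conv_lhs => rw [h1]
  rw [diffusionStep, ← Finset.sum_sub_distrib]
  refine Finset.sum_congr rfl fun m _ => ?_
  rw [← smul_sub]
  congr 1
  abel

theorem sum_sub_diffusionStep (hA : A ∈ doublyStochastic ℝ (Fin K)) (μ : ℝ) (wo : Param M)
    (w g : Fin K → Param M) :
    ∑ k, (wo - diffusionStep A μ w g k) = ∑ m, (wo - w m + μ • g m) := by
  simp only [sub_diffusionStep hA]
  rw [Finset.sum_comm]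
  simp only [← Finset.sum_smul, sum_row_of_mem_doublyStochastic hA, one_smul]

theorem sum_smul_sub_diffusionStep (hA : A ∈ doublyStochastic ℝ (Fin K))
    (hE : IsEigendecomposition A VR J) (μ : ℝ) (wo : Param M) (w g : Fin K → Param M)
    (j : Fin (K - 1)) :
    ∑ k, VR k j • (wo - diffusionStep A μ w g k)
      = J j j • ∑ m, VR m j • (wo - w m + μ • g m) := by
  simp only [sub_diffusionStep hA, Finset.smul_sum, smul_smul]
  rw [Finset.sum_comm]
  refine Finset.sum_congr rfl fun m _ => ?_
  rw [← Finset.sum_smul, ← hE.sum_mul_eq]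
  simp only [mul_comm]

theorem bias_eq {X : Type*} (hE : IsEigendecomposition A VR J) (L : LearningProblem K M X) (μ : ℝ)
    (wo : Param M) (j : Fin (K - 1)) :
    L.bias A VR μ wo j = J j j • ∑ m, VR m j • μ • ∇ (L.risk m) wo := by
  simp only [LearningProblem.bias, Finset.smul_sum, smul_smul]
  rw [Finset.sum_comm]
  refine Finset.sum_congr rfl fun m _ => ?_
  rw [← Finset.sum_smul, ← mul_assoc, ← hE.sum_mul_eq, Finset.sum_mul]
  congr 1
  exact Finset.sum_congr rfl fun k _ => by ring

theorem sum_norm_smul_sum_sq_le (VR : Matrix (Fin K) (Fin (K - 1)) ℝ) {r : ℝ}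
    (hr : ∀ j, |J j j| ≤ r) (x : Fin K → Param M) :
    ∑ j, ‖J j j • ∑ k, VR k j • x k‖ ^ 2 ≤ r ^ 2 * ∑ j, ‖∑ k, VR k j • x k‖ ^ 2 := by
  rw [Finset.mul_sum]
  refine Finset.sum_le_sum fun j _ => ?_
  rw [norm_smul, mul_pow, Real.norm_eq_abs]
  gcongr
  exact hr j

theorem sum_norm_sum_sq_le [NeZero K] (hE : IsEigendecomposition A VR J) (x : Fin K → Param M) :
    ∑ j, ‖∑ k, VR k j • x k‖ ^ 2 ≤ ∑ k, ‖x k‖ ^ 2 := by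
  rw [hE.sum_norm_sq x]
  have : 0 ≤ (K : ℝ)⁻¹ * ‖∑ k, x k‖ ^ 2 := by positivity
  linarith

/-- The centroid of the exact gradient step. -/
theorem centroidError_gradient_step_le [NeZero K] {X : Type*} {L : LearningProblem K M X}
    {ν δ : ℝ} (h : L.ConvexSmooth ν δ) (hν : 0 < ν) (hE : IsEigendecomposition A VR J)
    {wo : Param M} (hwo : IsMinOn L.aggregateRisk Set.univ wo) {μ : ℝ} (hμ : 0 < μ)
    (w : Fin K → Param M) :
    (K : ℝ)⁻¹ * ‖∑ m, (wo - w m + μ • ∇ (L.risk m) (w m))‖ ^ 2 ≤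
      (1 + μ * ν) * ((1 - 2 * μ * ν + μ ^ 2 * δ ^ 2) * centroidError wo w)
        + (1 + (μ * ν)⁻¹) * (μ ^ 2 * δ ^ 2 * disagreement VR wo w) := by
  have hK : (0 : ℝ) < K := Nat.cast_pos.mpr (NeZero.pos K)
  set x : Param M := (K : ℝ)⁻¹ • ∑ m, (wo - w m) with hx
  have hKx : ∑ m, (wo - w m) = (K : ℝ) • x := by rw [hx, smul_inv_smul₀ hK.ne']
  have hX : centroidError wo w = K * ‖x‖ ^ 2 := by
    rw [centroidError, hKx, norm_smul, Real.norm_of_nonneg hK.le]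
    field_simp
  -- `wo - x` is the average model, and squared distances to the average add up to the disagreement.
  have hY : ∑ m, ‖w m - (wo - x)‖ ^ 2 = disagreement VR wo w := by
    have h1 : ∀ m, w m - (wo - x) = -(wo - w m - x) := fun m => by abel
    simp only [h1, norm_neg]
    rw [hE.sum_norm_sq]
    simp only [Finset.sum_sub_distrib, smul_sub, ← Finset.sum_smul, hE.orthogonal_one, zero_smul,
      sub_zero]
    rw [← Finset.sum_sub_distrib, hKx]
    simp [disagreement, smul_sub, Finset.sum_sub_distrib, ← Finset.sum_smul, hE.orthogonal_one,
      ← Nat.cast_smul_eq_nsmul ℝ]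
  -- `u` is the step with all gradients taken at the average model; `v` corrects for their actual
  -- positions.
  set u : Param M := (K : ℝ) • x + μ • ∑ m, ∇ (L.risk m) (wo - x) with hu
  set v : Param M := μ • ∑ m, (∇ (L.risk m) (w m) - ∇ (L.risk m) (wo - x)) with hv
  have huv : ∑ m, (wo - w m + μ • ∇ (L.risk m) (w m)) = u + v := by
    rw [Finset.sum_add_distrib, hKx, ← Finset.smul_sum, hu, hv, Finset.sum_sub_distrib, smul_sub]
    abel
  have hsum : ∑ m, ∇ (L.risk m) (wo - x) = ∑ m, (∇ (L.risk m) (wo - x) - ∇ (L.risk m) wo) := by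
    rw [Finset.sum_sub_distrib, h.sum_gradient_risk_eq_zero hwo, sub_zero]
  have hinner : ⟪x, ∑ m, ∇ (L.risk m) (wo - x)⟫ ≤ -(K * (ν * ‖x‖ ^ 2)) := by
    rw [hsum, inner_sum]
    have h1 : ∀ m ∈ Finset.univ, ⟪x, ∇ (L.risk m) (wo - x) - ∇ (L.risk m) wo⟫
        ≤ -(ν * ‖x‖ ^ 2) := fun m _ => by
      have := h.mul_norm_sq_le_inner m wo (wo - x)
      rw [sub_sub_cancel_left, norm_neg, inner_neg_right, real_inner_comm] at this
      linarith
    simpa using Finset.sum_le_sum h1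
  have hnorm : (K : ℝ)⁻¹ * ‖∑ m, ∇ (L.risk m) (wo - x)‖ ^ 2 ≤ K * (δ ^ 2 * ‖x‖ ^ 2) := by
    rw [hsum]
    refine (inv_card_mul_norm_sum_sq_le _).trans ?_
    have h1 : ∀ m ∈ Finset.univ, ‖∇ (L.risk m) (wo - x) - ∇ (L.risk m) wo‖ ^ 2
        ≤ δ ^ 2 * ‖x‖ ^ 2 := fun m _ => by
      have := h.norm_gradient_risk_sub_le m wo (wo - x)
      rw [sub_sub_cancel_left, norm_neg] at this
      rw [← mul_pow]
      exact pow_le_pow_left₀ (norm_nonneg _) this 2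
    simpa using Finset.sum_le_sum h1
  have h1 : (K : ℝ)⁻¹ * ‖u‖ ^ 2 ≤ (1 - 2 * μ * ν + μ ^ 2 * δ ^ 2) * centroidError wo w := by
    have h2 : (K : ℝ)⁻¹ * ‖u‖ ^ 2 = K * ‖x‖ ^ 2 + 2 * μ * ⟪x, ∑ m, ∇ (L.risk m) (wo - x)⟫
        + μ ^ 2 * ((K : ℝ)⁻¹ * ‖∑ m, ∇ (L.risk m) (wo - x)‖ ^ 2) := by
      rw [hu, norm_add_sq_real, norm_smul (K : ℝ), norm_smul μ, inner_smul_left, inner_smul_right,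
        Real.norm_of_nonneg hK.le, Real.norm_of_nonneg hμ.le]
      simp only [conj_trivial]
      field_simp
    rw [h2, hX]
    have h3 := mul_le_mul_of_nonneg_left hinner (by positivity : 0 ≤ 2 * μ)
    have h4 := mul_le_mul_of_nonneg_left hnorm (by positivity : 0 ≤ μ ^ 2)
    linarith
  have h2 : (K : ℝ)⁻¹ * ‖v‖ ^ 2 ≤ μ ^ 2 * δ ^ 2 * disagreement VR wo w := by
    rw [hv, norm_smul, mul_pow, Real.norm_of_nonneg hμ.le, mul_left_comm, mul_assoc]
    refine mul_le_mul_of_nonneg_left ((inv_card_mul_norm_sum_sq_le _).trans ?_) (by positivity)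
    rw [← hY, Finset.mul_sum]
    refine Finset.sum_le_sum fun m _ => ?_
    rw [← mul_pow]
    exact pow_le_pow_left₀ (norm_nonneg _) (h.norm_gradient_risk_sub_le m (wo - x) (w m)) 2
  rw [huv]
  -- The weight `μν` spends half of the gain `2μν` and prices the disagreement at order `μ`.
  have h3 := mul_le_mul_of_nonneg_left (norm_add_sq_le_weighted u v (mul_pos hμ hν))
    (inv_nonneg.mpr hK.le)
  have h4 := mul_le_mul_of_nonneg_left h1 (by positivity : 0 ≤ 1 + μ * ν)
  have h5 := mul_le_mul_of_nonneg_left h2 (by positivity : 0 ≤ 1 + (μ * ν)⁻¹)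
  linarith

/-- The disagreement of the exact gradient step. -/
theorem disagreement_gradient_step_le [NeZero K] {X : Type*} {L : LearningProblem K M X}
    {ν δ τ : ℝ} (h : L.ConvexSmooth ν δ) (hE : IsEigendecomposition A VR J)
    (hτ : ∀ j, |J j j| ≤ τ) (hτ0 : 0 < τ) (hτ1 : τ < 1) (wo : Param M) (μ : ℝ)
    (w : Fin K → Param M) :
    ∑ j, ‖J j j • ∑ m, VR m j • (wo - w m + μ • ∇ (L.risk m) (w m))‖ ^ 2 ≤
      τ * disagreement VR wo w + 2 / (1 - τ) * (μ ^ 2 * δ ^ 2 * sqError wo w)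
        + 2 / (1 - τ) * ∑ j, ‖L.bias A VR μ wo j‖ ^ 2 := by
  have hτ' : 0 < 1 - τ := sub_pos.mpr hτ1
  -- Subtracting the gradients at `wo` isolates the bias and leaves increments that are Lipschitz in
  -- the error.
  set d : Fin K → Param M := fun m => μ • (∇ (L.risk m) (w m) - ∇ (L.risk m) wo) with hd
  have hj : ∀ j, J j j • ∑ m, VR m j • (wo - w m + μ • ∇ (L.risk m) (w m))
      = J j j • ∑ m, VR m j • (wo - w m)
        + (J j j • ∑ m, VR m j • d m + L.bias A VR μ wo j) := fun j => by
    rw [bias_eq hE, ← smul_add, ← smul_add, ← Finset.sum_add_distrib, ← Finset.sum_add_distrib]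
    congr 1
    refine Finset.sum_congr rfl fun m _ => ?_
    rw [← smul_add, ← smul_add, ← smul_add, sub_add_cancel]
  -- This weight gives the factors `1/τ` and `1/(1 - τ)`; against the contraction `τ²` the first
  -- leaves `τ`.
  have hs : 0 < (1 - τ) / τ := by positivity
  have h1 : ∀ j ∈ Finset.univ, ‖J j j • ∑ m, VR m j • (wo - w m + μ • ∇ (L.risk m) (w m))‖ ^ 2
      ≤ τ⁻¹ * ‖J j j • ∑ m, VR m j • (wo - w m)‖ ^ 2
        + (2 / (1 - τ) * ‖J j j • ∑ m, VR m j • d m‖ ^ 2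
          + 2 / (1 - τ) * ‖L.bias A VR μ wo j‖ ^ 2) := fun j _ => by
    rw [hj]
    refine (norm_add_sq_le_weighted _ _ hs).trans (add_le_add (le_of_eq ?_) ?_)
    · congr 1; field_simp; ring
    · have h2 := norm_add_sq_le_weighted (J j j • ∑ m, VR m j • d m) (L.bias A VR μ wo j) one_pos
      have h3 : 1 + ((1 - τ) / τ)⁻¹ = 1 / (1 - τ) := by field_simp; ring
      rw [h3]
      refine (mul_le_mul_of_nonneg_left h2 (by positivity)).trans (le_of_eq ?_)
      ring
  have h2 : ∑ j, ‖J j j • ∑ m, VR m j • (wo - w m)‖ ^ 2 ≤ τ ^ 2 * disagreement VR wo w :=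
    sum_norm_smul_sum_sq_le VR hτ _
  have h3 : ∑ j, ‖J j j • ∑ m, VR m j • d m‖ ^ 2 ≤ μ ^ 2 * δ ^ 2 * sqError wo w := by
    refine (sum_norm_smul_sum_sq_le VR (fun j => (hτ j).trans hτ1.le) _).trans ?_
    rw [one_pow, one_mul]
    refine (sum_norm_sum_sq_le hE d).trans ?_
    rw [sqError, Finset.mul_sum]
    refine Finset.sum_le_sum fun m _ => ?_
    rw [hd, norm_smul, mul_pow, Real.norm_eq_abs, sq_abs, mul_assoc, norm_sub_rev wo, ← mul_pow δ]
    gcongr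
    exact h.norm_gradient_risk_sub_le m wo (w m)
  refine (Finset.sum_le_sum h1).trans ?_
  rw [Finset.sum_add_distrib, Finset.sum_add_distrib, ← Finset.mul_sum, ← Finset.mul_sum,
    ← Finset.mul_sum, ← add_assoc]
  refine add_le_add (add_le_add ?_ (mul_le_mul_of_nonneg_left h3 (by positivity))) le_rfl
  refine (mul_le_mul_of_nonneg_left h2 (by positivity)).trans (le_of_eq ?_)
  field_simp

/-- The centroid of a gradient step with gradient noise `s`. -/
theorem centroidError_diffusionStep_le [NeZero K] (hA : A ∈ doublyStochastic ℝ (Fin K))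
    (μ : ℝ) (wo : Param M) (w g s : Fin K → Param M) :
    centroidError wo (diffusionStep A μ w fun m => g m + s m) ≤
      (K : ℝ)⁻¹ * ‖∑ m, (wo - w m + μ • g m)‖ ^ 2
        + ∑ m, (2 * μ * ⟪(K : ℝ)⁻¹ • ∑ m, (wo - w m + μ • g m), s m⟫ + μ ^ 2 * ‖s m‖ ^ 2) := by
  set a := ∑ m, (wo - w m + μ • g m) with ha
  have h1 : ∑ m, (wo - w m + μ • (g m + s m)) = a + μ • ∑ m, s m := by
    rw [ha, Finset.smul_sum, ← Finset.sum_add_distrib]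
    simp only [smul_add, add_assoc]
  rw [centroidError, sum_sub_diffusionStep hA, h1, norm_add_sq_real, Finset.sum_add_distrib,
    ← Finset.mul_sum, ← Finset.mul_sum, ← inner_sum, inner_smul_left, inner_smul_right, norm_smul,
    mul_pow, Real.norm_eq_abs, sq_abs, conj_trivial]
  -- Cauchy–Schwarz for the square of the summed noise: independence of the draws between agents is
  -- not needed.
  have := mul_le_mul_of_nonneg_left (inv_card_mul_norm_sum_sq_le s) (sq_nonneg μ)
  linarith

/-- The disagreement after a gradient step with gradient noise `s`. -/
theorem disagreement_diffusionStep_le [NeZero K] (hA : A ∈ doublyStochastic ℝ (Fin K))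
    (hE : IsEigendecomposition A VR J) (hJ : ∀ j, |J j j| ≤ 1)
    (μ : ℝ) (wo : Param M) (w g s : Fin K → Param M) :
    disagreement VR wo (diffusionStep A μ w fun m => g m + s m) ≤
      ∑ j, ‖J j j • ∑ m, VR m j • (wo - w m + μ • g m)‖ ^ 2
        + ∑ m, (2 * μ * ⟪∑ j, (J j j * VR m j) • J j j • ∑ m, VR m j • (wo - w m + μ • g m), s m⟫
          + μ ^ 2 * ‖s m‖ ^ 2) := by
  set a : Fin (K - 1) → Param M := fun j => J j j • ∑ m, VR m j • (wo - w m + μ • g m) with ha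
  have h1 : ∀ j, ∑ k, VR k j • (wo - diffusionStep A μ w (fun m => g m + s m) k)
      = a j + μ • J j j • ∑ m, VR m j • s m := fun j => by
    rw [sum_smul_sub_diffusionStep hA hE, ha, smul_comm μ, ← smul_add, Finset.smul_sum (r := μ),
      ← Finset.sum_add_distrib]
    congr 1
    refine Finset.sum_congr rfl fun m _ => ?_
    rw [smul_comm μ, ← smul_add, smul_add μ, add_assoc]
  -- Regrouped by agent, each noise `s m` is paired with a vector that does not involve `s`, so its
  -- cross term can be averaged out separately.
  have h2 : ∑ j, ⟪a j, J j j • ∑ m, VR m j • s m⟫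
      = ∑ m, ⟪∑ j, (J j j * VR m j) • a j, s m⟫ := by
    simp only [inner_smul_right, inner_sum, sum_inner, inner_smul_left, conj_trivial,
      Finset.mul_sum]
    rw [Finset.sum_comm]
    simp only [mul_assoc]
  have h3 : ∑ j, ‖J j j • ∑ m, VR m j • s m‖ ^ 2 ≤ ∑ m, ‖s m‖ ^ 2 := by
    refine (sum_norm_smul_sum_sq_le VR hJ s).trans ?_
    rw [one_pow, one_mul]
    exact sum_norm_sum_sq_le hE s
  rw [disagreement]
  simp only [h1, norm_add_sq_real, inner_smul_right, norm_smul μ, mul_pow, Real.norm_eq_abs, sq_abs,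
    Finset.sum_add_distrib, ← Finset.mul_sum]
  simp only [inner_smul_right] at h2
  rw [← h2]
  have := mul_le_mul_of_nonneg_left h3 (sq_nonneg μ)
  have h4 : ∑ j, 2 * (μ * (J j j * ⟪a j, ∑ m, VR m j • s m⟫))
      = 2 * μ * ∑ j, J j j * ⟪a j, ∑ m, VR m j • s m⟫ := by
    rw [Finset.mul_sum]
    exact Finset.sum_congr rfl fun j _ => by ring
  linarith

end Step

/-! ### The privacy noise does not enter the models -/

/-- An exact cancellation for every outcome, whatever the split and the keys: the two groups
contribute the same double sum with opposite signs. -/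
theorem LocalGraphHomomorphicProcess.sum_smul_noise {K M : ℕ} {A : Matrix (Fin K) (Fin K) ℝ}
    {Ω : Type*} [MeasurableSpace Ω] {P : Measure Ω} (G : LocalGraphHomomorphicProcess A M P)
    (σg : ℝ) (i : ℕ) (k : Fin K) (ω : Ω) :
    ∑ m ∈ neighbourhood A k, A m k • G.noise σg i m k ω = 0 := by
  have hne : ∀ m ∈ neighbourhood A k, A m k ≠ 0 := fun m hm => by
    simp only [neighbourhood, Finset.mem_filter] at hm
    exact hm.2.ne'
  have hsub := G.posGroup_subset i k ω
  rw [← Finset.sum_sdiff hsub]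
  have h1 : ∑ m ∈ neighbourhood A k \ G.posGroup i k ω, A m k • G.noise σg i m k ω
      = -∑ m ∈ neighbourhood A k \ G.posGroup i k ω, ∑ ℓ ∈ G.posGroup i k ω,
        G.pairNoise σg i k ℓ m ω := by
    rw [← Finset.sum_neg_distrib]
    refine Finset.sum_congr rfl fun m hm => ?_
    rw [Finset.mem_sdiff] at hm
    rw [noise, if_neg hm.2, smul_neg, smul_inv_smul₀ (hne m hm.1)]
  have h2 : ∑ m ∈ G.posGroup i k ω, A m k • G.noise σg i m k ω
      = ∑ m ∈ G.posGroup i k ω, ∑ ℓ ∈ neighbourhood A k \ G.posGroup i k ω,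
        G.pairNoise σg i k m ℓ ω := by
    refine Finset.sum_congr rfl fun m hm => ?_
    rw [noise, if_pos hm, smul_inv_smul₀ (hne m (hsub hm))]
  rw [h1, h2, Finset.sum_comm, neg_add_cancel]

/-- The adapt-then-combine diffusion strategy without privacy noise. -/
noncomputable def diffusionATC {K M : ℕ} {X : Type*} (L : LearningProblem K M X)
    (A : Matrix (Fin K) (Fin K) ℝ) {Ω : Type*} (init : Ω → Fin K → Param M)
    (draw : (k : Fin K) → ℕ → Ω → Fin (L.N k)) (μ : ℝ) : ℕ → Ω → Fin K → Param M
  | 0, ω => init ω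
  | i + 1, ω => diffusionStep A μ (diffusionATC L A init draw μ i ω) fun m =>
      ∇ (L.sampleLoss m (draw m i ω)) (diffusionATC L A init draw μ i ω m)

theorem privatizedATC_eq_diffusionATC {K M : ℕ} {X : Type*} (L : LearningProblem K M X)
    {A : Matrix (Fin K) (Fin K) ℝ} (hA : A ∈ doublyStochastic ℝ (Fin K)) {Ω : Type*}
    [MeasurableSpace Ω] {P : Measure Ω} (G : LocalGraphHomomorphicProcess A M P) (σg : ℝ)
    (init : Ω → Fin K → Param M) (draw : (k : Fin K) → ℕ → Ω → Fin (L.N k)) (μ : ℝ) :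
    privatizedATC L A G σg init draw μ = diffusionATC L A init draw μ := by
  funext i
  induction i with
  | zero => rfl
  | succ i ih =>
    funext ω k
    rw [privatizedATC, diffusionATC, diffusionStep, ih]
    simp only [smul_add (A _ k)]
    rw [Finset.sum_add_distrib, G.sum_smul_noise, add_zero]
    refine Finset.sum_subset (Finset.subset_univ _) fun m _ hm => ?_
    have h0 : A m k = 0 := by
      refine le_antisymm (not_lt.mp fun h => hm ?_) (nonneg_of_mem_doublyStochastic hA)
      simpa [neighbourhood] using h
    rw [h0, zero_smul]

/-! ### Measurability and moments of the models -/

section Moments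

variable {K M : ℕ} {X : Type*} {L : LearningProblem K M X} {ν δ : ℝ} {Ω : Type*}
  [MeasurableSpace Ω]

theorem measurable_gradient_sampleLoss (h : L.ConvexSmooth ν δ) {k : Fin K}
    {b : Ω → Fin (L.N k)} (hb : Measurable b) {w : Ω → Param M} (hw : Measurable w) :
    Measurable fun ω => ∇ (L.sampleLoss k (b ω)) (w ω) := by
  have h1 : Measurable fun q : Fin (L.N k) × Param M => ∇ (L.sampleLoss k q.1) q.2 :=
    measurable_from_prod_countable_right fun n =>
      (h.loss_twice_differentiable k n).continuous.measurable
  exact h1.comp (hb.prodMk hw)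

theorem memLp_gradient_sampleLoss (h : L.ConvexSmooth ν δ) {k : Fin K} {P : Measure Ω}
    [IsFiniteMeasure P] {b : Ω → Fin (L.N k)} (hb : Measurable b) {w : Ω → Param M}
    (hwm : Measurable w) (hw : MemLp w 2 P) :
    MemLp (fun ω => ∇ (L.sampleLoss k (b ω)) (w ω)) 2 P := by
  have hg : MemLp (fun ω => ∑ n, ‖∇ (L.sampleLoss k n) 0‖ + δ * ‖w ω‖) 2 P :=
    (memLp_const (∑ n, ‖∇ (L.sampleLoss k n) 0‖)).add (hw.norm.const_mul δ)
  refine hg.of_le (measurable_gradient_sampleLoss h hb hwm).aestronglyMeasurable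
    (Eventually.of_forall fun ω => ?_)
  have h1 := h.loss_lipschitz k (b ω) 0 (w ω)
  rw [sub_zero] at h1
  have h2 := norm_le_norm_add_norm_sub' (∇ (L.sampleLoss k (b ω)) (w ω))
    (∇ (L.sampleLoss k (b ω)) 0)
  have h3 : ‖∇ (L.sampleLoss k (b ω)) 0‖ ≤ ∑ n, ‖∇ (L.sampleLoss k n) 0‖ :=
    Finset.single_le_sum (f := fun n => ‖∇ (L.sampleLoss k n) 0‖) (fun _ _ => norm_nonneg _)
      (Finset.mem_univ _)
  exact (h2.trans (add_le_add h3 h1)).trans (le_abs_self _)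

theorem continuous_gradient_risk (h : L.ConvexSmooth ν δ) (k : Fin K) :
    Continuous (∇ (L.risk k)) := by
  rw [show ∇ (L.risk k) = fun w => (L.N k : ℝ)⁻¹ • ∑ n, ∇ (L.sampleLoss k n) w from
    funext (h.gradient_risk k)]
  have h1 : Continuous fun w => ∑ n, ∇ (L.sampleLoss k n) w :=
    continuous_finsetSum _ fun n _ => (h.loss_twice_differentiable k n).continuous
  exact h1.const_smul (L.N k : ℝ)⁻¹

theorem memLp_gradient_risk (h : L.ConvexSmooth ν δ) (k : Fin K) {P : Measure Ω}
    [IsFiniteMeasure P] {w : Ω → Param M} (hwm : Measurable w) (hw : MemLp w 2 P) :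
    MemLp (fun ω => ∇ (L.risk k) (w ω)) 2 P := by
  simp only [h.gradient_risk]
  have h1 : MemLp (fun ω => ∑ n, ∇ (L.sampleLoss k n) (w ω)) 2 P := memLp_finsetSum _ fun n _ =>
    memLp_gradient_sampleLoss h (b := fun _ => n) measurable_const hwm hw
  exact h1.const_smul (L.N k : ℝ)⁻¹

/-- Only draws before time `n` are assumed measurable, so that the σ-algebra generated by the past
can serve as the one on `Ω`. -/
theorem measurable_diffusionATC (h : L.ConvexSmooth ν δ) {A : Matrix (Fin K) (Fin K) ℝ} {μ : ℝ}
    {init : Ω → Fin K → Param M} (hinit : Measurable init)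
    {draw : (k : Fin K) → ℕ → Ω → Fin (L.N k)} (n : ℕ)
    (hdraw : ∀ k, ∀ j < n, Measurable (draw k j)) {i : ℕ} (hi : i ≤ n) :
    Measurable (diffusionATC L A init draw μ i) := by
  induction i with
  | zero => exact hinit
  | succ i ih =>
    have hw := fun m => (measurable_pi_apply m).comp (ih (Nat.le_of_succ_le hi))
    refine measurable_pi_lambda _ fun k => ?_
    simp only [diffusionATC, diffusionStep]
    refine Finset.measurable_fun_sum _ fun m _ => ?_
    exact ((hw m).sub ((measurable_gradient_sampleLoss h (hdraw m i hi) (hw m)).const_smul μ)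
      ).const_smul (A m k)

theorem memLp_diffusionATC (h : L.ConvexSmooth ν δ) {A : Matrix (Fin K) (Fin K) ℝ} {μ : ℝ}
    {P : Measure Ω} [IsFiniteMeasure P] {init : Ω → Fin K → Param M} (hinit : Measurable init)
    (hLp : ∀ k, MemLp (fun ω => init ω k) 2 P)
    {draw : (k : Fin K) → ℕ → Ω → Fin (L.N k)} (hdraw : ∀ k j, Measurable (draw k j))
    (i : ℕ) (k : Fin K) : MemLp (fun ω => diffusionATC L A init draw μ i ω k) 2 P := by
  induction i generalizing k with
  | zero => exact hLp k
  | succ i ih =>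
    have hw := fun m => (measurable_pi_apply m).comp
      (measurable_diffusionATC h (A := A) (μ := μ) hinit i (fun k j _ => hdraw k j) le_rfl)
    simp only [diffusionATC, diffusionStep]
    exact memLp_finsetSum _ fun m _ => ((ih m).sub
      ((memLp_gradient_sampleLoss h (hdraw m i) (hw m) (ih m)).const_smul μ)).const_smul (A m k)

/-- The iterate at time `i` is a function of the initial models and the earlier draws. -/
theorem indepFun_diffusionATC (h : L.ConvexSmooth ν δ) {A : Matrix (Fin K) (Fin K) ℝ} {μ : ℝ}
    {P : Measure Ω} {init : Ω → Fin K → Param M} {draw : (k : Fin K) → ℕ → Ω → Fin (L.N k)}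
    (hS : IsUniformSampling L P init draw) (i : ℕ) (k : Fin K) :
    IndepFun (draw k i) (diffusionATC L A init draw μ i) P := by
  set Z := fun ω => (init ω, fun (j : Fin i) (k : Fin K) => draw k j ω) with hZ
  have h1 : IndepFun (draw k i) Z P :=
    (hS.independent i).comp (measurable_pi_apply k) measurable_id
  have hZm : @Measurable _ _ (MeasurableSpace.comap Z inferInstance) _ Z := comap_measurable Z
  have h2 : @Measurable _ _ (MeasurableSpace.comap Z inferInstance) _
      (diffusionATC L A init draw μ i) := by
    refine @measurable_diffusionATC K M X L ν δ Ω (MeasurableSpace.comap Z inferInstance) h A μ init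
      (measurable_fst.comp hZm) draw i (fun k j hj => ?_) i le_rfl
    exact ((measurable_pi_apply k).comp (measurable_pi_apply (⟨j, hj⟩ : Fin i))).comp
      (measurable_snd.comp hZm)
  rw [IndepFun_iff_Indep] at h1 ⊢
  exact indep_of_indep_of_le_right h1 h2.comap_le

end Moments

theorem MeasureTheory.MemLp.integrable_real_inner {Ω E : Type*} [MeasurableSpace Ω] {P : Measure Ω}
    [NormedAddCommGroup E] [InnerProductSpace ℝ E] {f g : Ω → E} (hf : MemLp f 2 P)
    (hg : MemLp g 2 P) : Integrable (fun ω => ⟪f ω, g ω⟫) P :=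
  (hf.norm.integrable_mul hg.norm).mono (hf.1.inner hg.1) (Eventually.of_forall fun ω =>
    (norm_inner_le_norm (f ω) (g ω)).trans (le_abs_self _))

/-! ### Expectations over a uniform index -/

/-- Stands in for conditioning on `Z`: split along the events `b = n` and factor each term by
independence. -/
theorem integral_uniform_index {Ω S : Type*} [MeasurableSpace Ω] [MeasurableSpace S]
    {P : Measure Ω} [IsProbabilityMeasure P] {N : ℕ} {b : Ω → Fin N} {Z : Ω → S}
    (hb : Measurable b) (hZ : Measurable Z) (hind : IndepFun b Z P)
    (hu : ∀ n, P {ω | b ω = n} = (N : ℝ≥0∞)⁻¹) {F : Fin N → S → ℝ} (hF : ∀ n, Measurable (F n))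
    (hi : ∀ n, Integrable (fun ω => F n (Z ω)) P) :
    Integrable (fun ω => F (b ω) (Z ω)) P ∧
      ∫ ω, F (b ω) (Z ω) ∂P = ∫ ω, (N : ℝ)⁻¹ * ∑ n, F n (Z ω) ∂P := by
  set χ : Fin N → Fin N → ℝ := fun n m => if m = n then 1 else 0 with hχ
  have hχm : ∀ n, Measurable (χ n) := fun n => measurable_of_finite _
  have h1 : (fun ω => F (b ω) (Z ω)) = fun ω => ∑ n, χ n (b ω) * F n (Z ω) := by
    funext ω
    simp [hχ]
  have hχi : ∀ n, ∫ ω, χ n (b ω) ∂P = (N : ℝ)⁻¹ := fun n => by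
    have h2 : (fun ω => χ n (b ω)) = Set.indicator {ω | b ω = n} 1 := by
      funext ω
      simp [hχ, Set.indicator_apply]
    rw [h2]
    change ∫ ω, Set.indicator (b ⁻¹' {n}) 1 ω ∂P = _
    rw [integral_indicator_one (hb (measurableSet_singleton n)), measureReal_def]
    change (P {ω | b ω = n}).toReal = _
    rw [hu]
    simp
  have h3 : ∀ n, Integrable (fun ω => χ n (b ω) * F n (Z ω)) P := fun n => by
    refine (hi n).mono (((hχm n).comp hb).mul ((hF n).comp hZ)).aestronglyMeasurable
      (Eventually.of_forall fun ω => ?_)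
    rw [norm_mul]
    refine mul_le_of_le_one_left (norm_nonneg _) ?_
    simp only [hχ]
    split_ifs <;> simp
  rw [h1]
  refine ⟨integrable_finsetSum _ fun n _ => h3 n, ?_⟩
  rw [integral_finsetSum _ fun n _ => h3 n, integral_const_mul, integral_finsetSum _ fun n _ => hi n,
    Finset.mul_sum]
  refine Finset.sum_congr rfl fun n _ => ?_
  have h4 := (hind.comp (hχm n) (hF n)).integral_fun_mul_eq_mul_integral
    ((hχm n).comp hb).aestronglyMeasurable ((hF n).comp hZ).aestronglyMeasurable
  simp only [Function.comp_apply] at h4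
  rw [h4, hχi]

/-- Averaging over the sample indices removes the cross terms with the gradient noise. -/
theorem integral_gradientNoise_term {K M : ℕ} {X : Type*} {L : LearningProblem K M X} {ν δ : ℝ}
    (h : L.ConvexSmooth ν δ) {Ω : Type*} [MeasurableSpace Ω] {P : Measure Ω}
    [IsProbabilityMeasure P] {W : Ω → Fin K → Param M} (hWm : Measurable W)
    (hW : ∀ k, MemLp (fun ω => W ω k) 2 P) {k : Fin K} {b : Ω → Fin (L.N k)} (hb : Measurable b)
    (hind : IndepFun b W P) (hu : ∀ n, P {ω | b ω = n} = (L.N k : ℝ≥0∞)⁻¹)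
    {H : (Fin K → Param M) → Param M} (hH : Measurable H) (hHW : MemLp (fun ω => H (W ω)) 2 P)
    (μ : ℝ) :
    Integrable (fun ω => 2 * μ * ⟪H (W ω), ∇ (L.sampleLoss k (b ω)) (W ω k) - ∇ (L.risk k) (W ω k)⟫
      + μ ^ 2 * ‖∇ (L.sampleLoss k (b ω)) (W ω k) - ∇ (L.risk k) (W ω k)‖ ^ 2) P ∧
    Integrable (fun ω => L.gradientNoiseVariance k (W ω k)) P ∧
    ∫ ω, (2 * μ * ⟪H (W ω), ∇ (L.sampleLoss k (b ω)) (W ω k) - ∇ (L.risk k) (W ω k)⟫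
      + μ ^ 2 * ‖∇ (L.sampleLoss k (b ω)) (W ω k) - ∇ (L.risk k) (W ω k)‖ ^ 2) ∂P
      = μ ^ 2 * ∫ ω, L.gradientNoiseVariance k (W ω k) ∂P := by
  set s : Fin (L.N k) → Param M → Param M := fun n w => ∇ (L.sampleLoss k n) w - ∇ (L.risk k) w
    with hs
  have hWk : Measurable fun ω => W ω k := (measurable_pi_apply k).comp hWm
  have hsm : ∀ n, Measurable (s n) := fun n =>
    ((h.loss_twice_differentiable k n).continuous.sub (continuous_gradient_risk h k)).measurable
  have hsL : ∀ n, MemLp (fun ω => s n (W ω k)) 2 P := fun n =>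
    (memLp_gradient_sampleLoss h (b := fun _ => n) measurable_const hWk (hW k)).sub
      (memLp_gradient_risk h k hWk (hW k))
  have hsq : ∀ n, Integrable (fun ω => ‖s n (W ω k)‖ ^ 2) P := fun n =>
    (hsL n).integrable_norm_pow two_ne_zero
  set F : Fin (L.N k) → (Fin K → Param M) → ℝ := fun n w =>
    2 * μ * ⟪H w, s n (w k)⟫ + μ ^ 2 * ‖s n (w k)‖ ^ 2 with hF
  have hFm : ∀ n, Measurable (F n) := fun n => by
    have h1 : Measurable fun w : Fin K → Param M => s n (w k) := (hsm n).comp (measurable_pi_apply k)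
    exact ((hH.inner h1).const_mul _).add ((h1.norm.pow_const 2).const_mul _)
  have hFi : ∀ n, Integrable (fun ω => F n (W ω)) P := fun n =>
    ((hHW.integrable_real_inner (hsL n)).const_mul _).add ((hsq n).const_mul _)
  obtain ⟨h1, h2⟩ := integral_uniform_index hb hWm hind hu hFm hFi
  refine ⟨h1, (integrable_finsetSum _ fun n _ => hsq n).const_mul _, h2.trans ?_⟩
  rw [← integral_const_mul]
  congr 1
  funext ω
  have h3 : ∑ n, s n (W ω k) = 0 := h.sum_gradient_sub k (W ω k)
  simp only [hF, Finset.sum_add_distrib, ← Finset.mul_sum, ← inner_sum, h3, inner_zero_right,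
    mul_zero, zero_add, LearningProblem.gradientNoiseVariance]
  ring

/-! ### Mean-square recursion -/

theorem LearningProblem.IsGradientNoiseBound.nonneg {K M : ℕ} {X : Type*}
    {L : LearningProblem K M X} {wo : Param M} {β2 σs2 : ℝ}
    (h : L.IsGradientNoiseBound wo β2 σs2) : 0 ≤ σs2 := by
  have h1 := h fun _ => wo
  simp only [sub_self, norm_zero, ne_eq, OfNat.ofNat_ne_zero, not_false_eq_true, zero_pow,
    Finset.sum_const_zero, mul_zero, zero_add] at h1
  refine le_trans (Finset.sum_nonneg fun k _ => ?_) h1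
  unfold LearningProblem.gradientNoiseVariance
  positivity

section MeanSquare

variable {K M : ℕ} {X : Type*} {L : LearningProblem K M X} {ν δ β2 σs2 : ℝ} {wo : Param M}
  {Ω : Type*} [MeasurableSpace Ω] {P : Measure Ω} {W : Ω → Fin K → Param M}

theorem integrable_sqError [IsFiniteMeasure P] (hW : ∀ k, MemLp (fun ω => W ω k) 2 P) :
    Integrable (fun ω => sqError wo (W ω)) P :=
  integrable_finsetSum _ fun k _ =>
    ((memLp_const wo).sub (hW k)).integrable_norm_pow two_ne_zero

theorem integrable_centroidError [IsFiniteMeasure P] (hW : ∀ k, MemLp (fun ω => W ω k) 2 P) :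
    Integrable (fun ω => centroidError wo (W ω)) P :=
  ((memLp_finsetSum _ fun k _ =>
    (memLp_const wo).sub (hW k)).integrable_norm_pow two_ne_zero).const_mul _

theorem integrable_disagreement [IsFiniteMeasure P] (VR : Matrix (Fin K) (Fin (K - 1)) ℝ)
    (hW : ∀ k, MemLp (fun ω => W ω k) 2 P) :
    Integrable (fun ω => disagreement VR wo (W ω)) P :=
  integrable_finsetSum _ fun j _ => (memLp_finsetSum _ fun k _ =>
    ((memLp_const wo).sub (hW k)).const_smul (VR k j)).integrable_norm_pow two_ne_zero

theorem integral_sqError_eq [NeZero K] [IsFiniteMeasure P] {A : Matrix (Fin K) (Fin K) ℝ}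
    {VR : Matrix (Fin K) (Fin (K - 1)) ℝ} {J : Matrix (Fin (K - 1)) (Fin (K - 1)) ℝ}
    (hE : IsEigendecomposition A VR J) (hW : ∀ k, MemLp (fun ω => W ω k) 2 P) :
    ∫ ω, sqError wo (W ω) ∂P
      = ∫ ω, centroidError wo (W ω) ∂P + ∫ ω, disagreement VR wo (W ω) ∂P := by
  rw [← integral_add (integrable_centroidError hW) (integrable_disagreement VR hW)]
  simp only [sqError_eq hE]

/-- Shared by both energies: the cross terms integrate to zero and the squares to the noise
variance. -/
theorem integral_le_of_gradientNoise [IsProbabilityMeasure P] (h : L.ConvexSmooth ν δ)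
    (hG : L.IsGradientNoiseBound wo β2 σs2) (hWm : Measurable W)
    (hW : ∀ k, MemLp (fun ω => W ω k) 2 P) {b : (k : Fin K) → Ω → Fin (L.N k)}
    (hb : ∀ k, Measurable (b k)) (hind : ∀ k, IndepFun (b k) W P)
    (hu : ∀ k n, P {ω | b k ω = n} = (L.N k : ℝ≥0∞)⁻¹)
    {H : Fin K → (Fin K → Param M) → Param M} (hH : ∀ k, Measurable (H k))
    (hHW : ∀ k, MemLp (fun ω => H k (W ω)) 2 P) {μ : ℝ} {f α : Ω → ℝ} (hf : Integrable f P)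
    (hα : Integrable α P)
    (hle : ∀ ω, f ω ≤ α ω + ∑ k, (2 * μ * ⟪H k (W ω),
        ∇ (L.sampleLoss k (b k ω)) (W ω k) - ∇ (L.risk k) (W ω k)⟫
      + μ ^ 2 * ‖∇ (L.sampleLoss k (b k ω)) (W ω k) - ∇ (L.risk k) (W ω k)‖ ^ 2)) :
    ∫ ω, f ω ∂P ≤ ∫ ω, α ω ∂P + μ ^ 2 * (β2 * ∫ ω, sqError wo (W ω) ∂P + σs2) := by
  have key := fun k => integral_gradientNoise_term h hWm hW (hb k) (hind k) (hu k) (hH k) (hHW k) μ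
  have h1 := integrable_finsetSum Finset.univ fun k _ => (key k).1
  refine (integral_mono hf (hα.add h1) hle).trans ?_
  simp only [Pi.add_apply]
  rw [integral_add hα h1, integral_finsetSum _ fun k _ => (key k).1,
    Finset.sum_congr rfl fun k _ => (key k).2.2, ← Finset.mul_sum,
    ← integral_finsetSum _ fun k _ => (key k).2.1]
  have h2 : ∫ ω, ∑ k, L.gradientNoiseVariance k (W ω k) ∂P
      ≤ ∫ ω, (β2 * sqError wo (W ω) + σs2) ∂P :=
    integral_mono (integrable_finsetSum _ fun k _ => (key k).2.1)
      (((integrable_sqError hW).const_mul _).add (integrable_const _)) fun ω => hG (W ω)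
  rw [integral_add ((integrable_sqError hW).const_mul _) (integrable_const _), integral_const_mul,
    integral_const, probReal_univ, one_smul] at h2
  exact add_le_add le_rfl (mul_le_mul_of_nonneg_left h2 (sq_nonneg μ))

/-- The mean-square recursion of the centroid and of the disagreement over one iteration. -/
theorem integral_diffusionStep_le [NeZero K] [IsProbabilityMeasure P] (h : L.ConvexSmooth ν δ)
    (hν : 0 < ν) {A : Matrix (Fin K) (Fin K) ℝ} (hA : A ∈ doublyStochastic ℝ (Fin K))
    {VR : Matrix (Fin K) (Fin (K - 1)) ℝ} {J : Matrix (Fin (K - 1)) (Fin (K - 1)) ℝ}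
    (hE : IsEigendecomposition A VR J) {τ : ℝ} (hJ : ∀ j, |J j j| ≤ τ) (hτ0 : 0 < τ) (hτ1 : τ < 1)
    (hwo : IsMinOn L.aggregateRisk Set.univ wo) (hG : L.IsGradientNoiseBound wo β2 σs2)
    (hWm : Measurable W) (hW : ∀ k, MemLp (fun ω => W ω k) 2 P)
    {b : (k : Fin K) → Ω → Fin (L.N k)} (hb : ∀ k, Measurable (b k))
    (hind : ∀ k, IndepFun (b k) W P) (hu : ∀ k n, P {ω | b k ω = n} = (L.N k : ℝ≥0∞)⁻¹)
    {μ : ℝ} (hμ : 0 < μ) {W' : Ω → Fin K → Param M}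
    (hW' : ∀ ω, W' ω = diffusionStep A μ (W ω) fun m => ∇ (L.sampleLoss m (b m ω)) (W ω m))
    (hW'L : ∀ k, MemLp (fun ω => W' ω k) 2 P) :
    ∫ ω, centroidError wo (W' ω) ∂P ≤
      (1 + μ * ν) * ((1 - 2 * μ * ν + μ ^ 2 * δ ^ 2) * ∫ ω, centroidError wo (W ω) ∂P)
        + (1 + (μ * ν)⁻¹) * (μ ^ 2 * δ ^ 2 * ∫ ω, disagreement VR wo (W ω) ∂P)
        + μ ^ 2 * (β2 * ∫ ω, sqError wo (W ω) ∂P + σs2) ∧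
    ∫ ω, disagreement VR wo (W' ω) ∂P ≤
      τ * ∫ ω, disagreement VR wo (W ω) ∂P
        + 2 / (1 - τ) * (μ ^ 2 * δ ^ 2 * ∫ ω, sqError wo (W ω) ∂P)
        + 2 / (1 - τ) * ∑ j, ‖L.bias A VR μ wo j‖ ^ 2
        + μ ^ 2 * (β2 * ∫ ω, sqError wo (W ω) ∂P + σs2) := by
  set D : Fin K → (Fin K → Param M) → Param M := fun m w => wo - w m + μ • ∇ (L.risk m) (w m)
    with hD
  have hDm : ∀ m, Measurable (D m) := fun m => by
    have h1 : Measurable fun w : Fin K → Param M => ∇ (L.risk m) (w m) :=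
      (continuous_gradient_risk h m).measurable.comp (measurable_pi_apply m)
    exact (measurable_const.sub (measurable_pi_apply m)).add (h1.const_smul μ)
  have hDL : ∀ m, MemLp (fun ω => D m (W ω)) 2 P := fun m =>
    ((memLp_const wo).sub (hW m)).add
      ((memLp_gradient_risk h m ((measurable_pi_apply m).comp hWm) (hW m)).const_smul μ)
  have hstep : ∀ ω, W' ω = diffusionStep A μ (W ω) fun m => ∇ (L.risk m) (W ω m)
      + (∇ (L.sampleLoss m (b m ω)) (W ω m) - ∇ (L.risk m) (W ω m)) := fun ω => by
    simp only [hW', add_sub_cancel]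
  have iX := integrable_centroidError (wo := wo) hW
  have iY := integrable_disagreement (wo := wo) VR hW
  have iS := integrable_sqError (wo := wo) hW
  constructor
  · have hSm : Measurable fun w => ∑ m, D m w := Finset.measurable_fun_sum _ fun m _ => hDm m
    have hSL : MemLp (fun ω => ∑ m, D m (W ω)) 2 P := memLp_finsetSum _ fun m _ => hDL m
    have hα : Integrable (fun ω => (K : ℝ)⁻¹ * ‖∑ m, D m (W ω)‖ ^ 2) P :=
      (hSL.integrable_norm_pow two_ne_zero).const_mul _
    have h1 := integral_le_of_gradientNoise h hG hWm hW hb hind hu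
      (H := fun _ w => (K : ℝ)⁻¹ • ∑ m, D m w) (fun _ => hSm.const_smul (K : ℝ)⁻¹)
      (fun _ => hSL.const_smul (K : ℝ)⁻¹) (μ := μ) (integrable_centroidError (wo := wo) hW'L) hα
      fun ω => by rw [hstep]; exact centroidError_diffusionStep_le hA μ wo _ _ _
    refine h1.trans (add_le_add ?_ le_rfl)
    have i1 := (iX.const_mul (1 - 2 * μ * ν + μ ^ 2 * δ ^ 2)).const_mul (1 + μ * ν)
    have i2 := (iY.const_mul (μ ^ 2 * δ ^ 2)).const_mul (1 + (μ * ν)⁻¹)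
    refine (integral_mono hα (i1.add i2) fun ω =>
      centroidError_gradient_step_le h hν hE hwo hμ (W ω)).trans (le_of_eq ?_)
    simp only [Pi.add_apply]
    rw [integral_add i1 i2]
    simp only [integral_const_mul]
  · set a : Fin (K - 1) → (Fin K → Param M) → Param M := fun j w =>
      J j j • ∑ m, VR m j • D m w with ha
    have ham : ∀ j, Measurable (a j) := fun j => by
      have h1 : Measurable fun w => ∑ m, VR m j • D m w :=
        Finset.measurable_fun_sum _ fun m _ => (hDm m).const_smul (VR m j)
      exact h1.const_smul (J j j)
    have haL : ∀ j, MemLp (fun ω => a j (W ω)) 2 P := fun j => by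
      have h1 : MemLp (fun ω => ∑ m, VR m j • D m (W ω)) 2 P :=
        memLp_finsetSum _ fun m _ => (hDL m).const_smul (VR m j)
      exact h1.const_smul (J j j)
    have hα : Integrable (fun ω => ∑ j, ‖a j (W ω)‖ ^ 2) P :=
      integrable_finsetSum _ fun j _ => (haL j).integrable_norm_pow two_ne_zero
    have h1 := integral_le_of_gradientNoise h hG hWm hW hb hind hu
      (H := fun m w => ∑ j, (J j j * VR m j) • a j w)
      (fun m => Finset.measurable_fun_sum _ fun j _ => (ham j).const_smul (J j j * VR m j))
      (fun m => memLp_finsetSum _ fun j _ => (haL j).const_smul (J j j * VR m j))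
      (μ := μ) (integrable_disagreement (wo := wo) VR hW'L) hα
      fun ω => by
        rw [hstep]
        exact disagreement_diffusionStep_le hA hE (fun j => (hJ j).trans hτ1.le) μ wo _ _ _
    refine h1.trans (add_le_add ?_ le_rfl)
    have i1 := iY.const_mul τ
    have i2 := (iS.const_mul (μ ^ 2 * δ ^ 2)).const_mul (2 / (1 - τ))
    have i3 : Integrable (fun _ : Ω => 2 / (1 - τ) * ∑ j, ‖L.bias A VR μ wo j‖ ^ 2) P :=
      integrable_const _
    refine (integral_mono hα ((i1.add i2).add i3) fun ω =>
      disagreement_gradient_step_le h hE hJ hτ0 hτ1 wo μ (W ω)).trans (le_of_eq ?_)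
    rw [integral_add' (i1.add i2) i3, integral_add' i1 i2, integral_const, probReal_univ, one_smul]
    simp only [integral_const_mul]

end MeanSquare

/-! ### Size of the bias, steady state and constants -/

theorem sum_norm_bias_sq_le {K M : ℕ} [NeZero K] {X : Type*} {L : LearningProblem K M X}
    {ν δ ξ : ℝ} (h : L.ConvexSmooth ν δ) (hδ : 0 ≤ δ) {A : Matrix (Fin K) (Fin K) ℝ}
    {VR : Matrix (Fin K) (Fin (K - 1)) ℝ} {J : Matrix (Fin (K - 1)) (Fin (K - 1)) ℝ}
    (hE : IsEigendecomposition A VR J) (hJ : ∀ j, |J j j| ≤ 1) {wo : Param M}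
    {wloc : Fin K → Param M} (hd : L.BoundedDrift wo wloc ξ) (μ : ℝ) :
    ∑ j, ‖L.bias A VR μ wo j‖ ^ 2 ≤ K * δ ^ 2 * ξ ^ 2 * μ ^ 2 := by
  simp only [bias_eq hE]
  refine (sum_norm_smul_sum_sq_le VR hJ _).trans ?_
  rw [one_pow, one_mul]
  refine (sum_norm_sum_sq_le hE _).trans ?_
  have h1 : ∀ k ∈ Finset.univ, ‖μ • ∇ (L.risk k) wo‖ ^ 2 ≤ δ ^ 2 * ξ ^ 2 * μ ^ 2 := fun k _ => by
    rw [norm_smul, mul_pow, Real.norm_eq_abs, sq_abs, mul_comm, ← mul_pow δ]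
    gcongr
    exact h.norm_gradient_risk_le hδ hd k
  refine (Finset.sum_le_sum h1).trans (le_of_eq ?_)
  simp
  ring

theorem limsup_le_of_le_geometric {f : ℕ → ℝ} {c r B : ℝ} (hf : ∀ i, 0 ≤ f i) (hr0 : 0 ≤ r)
    (hr1 : r < 1) (h : ∀ i, f i ≤ c * r ^ i + B) : limsup f atTop ≤ B := by
  have ht : Tendsto (fun i : ℕ => c * r ^ i + B) atTop (nhds B) := by
    simpa using ((tendsto_pow_atTop_nhds_zero_of_lt_one hr0 hr1).const_mul c).add_const B
  rw [← ht.limsup_eq]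
  exact limsup_le_limsup (Eventually.of_forall h)
    -- A real `limsup` is monotone only under boundedness conditions; nonnegativity provides the one
    -- for `f`.
    (isBoundedUnder_of ⟨0, hf⟩ : IsBoundedUnder (· ≥ ·) atTop f).isCoboundedUnder_le
    ht.isBoundedUnder_le

/-- The entries of the rate matrix dominate the coefficients of the mean-square recursion. -/
theorem rate_coefficients_le {ν δ β2 τ μ : ℝ} (hν : 0 < ν) (hβ : 0 ≤ β2) (hτ0 : 0 < τ)
    (hτ1 : τ < 1) (hμ : 0 < μ) (hμ1 : μ ≤ 1) :
    (1 + μ * ν) * (1 - 2 * μ * ν + μ ^ 2 * δ ^ 2) + μ ^ 2 * β2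
      ≤ 1 - ν * μ + (δ ^ 2 + ν * δ ^ 2 + β2) * μ ^ 2 ∧
    (1 + (μ * ν)⁻¹) * (μ ^ 2 * δ ^ 2) + μ ^ 2 * β2 ≤ (δ ^ 2 + δ ^ 2 / ν + β2) * √μ ∧
    2 / (1 - τ) * (μ ^ 2 * δ ^ 2) + μ ^ 2 * β2 ≤ (2 * δ ^ 2 / (1 - τ) + β2) * μ ∧
    τ + (2 / (1 - τ) * (μ ^ 2 * δ ^ 2) + μ ^ 2 * β2) ≤ √τ + (2 * δ ^ 2 / (1 - τ) + β2) * μ ^ 2 := by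
  have hτ' : 0 < 1 - τ := sub_pos.mpr hτ1
  have hs : μ ≤ √μ := Real.le_sqrt_of_sq_le (by nlinarith)
  have hsτ : τ ≤ √τ := Real.le_sqrt_of_sq_le (by nlinarith)
  have hμ2 : μ ^ 2 ≤ μ := by nlinarith
  have hμ3 : μ ^ 3 ≤ μ ^ 2 := pow_le_pow_of_le_one hμ.le hμ1 (by norm_num)
  refine ⟨?_, ?_, ?_, ?_⟩
  · have h1 : μ ^ 3 * (ν * δ ^ 2) ≤ μ ^ 2 * (ν * δ ^ 2) :=
      mul_le_mul_of_nonneg_right hμ3 (by positivity)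
    have h2 : 0 ≤ μ ^ 2 * ν ^ 2 := by positivity
    linarith
  -- The coefficient is in fact `O(μ)`; `μ ≤ √μ` weakens it to the prescribed form, as `τ ≤ √τ` does
  -- for the last entry.
  · have h1 : (1 + (μ * ν)⁻¹) * (μ ^ 2 * δ ^ 2) + μ ^ 2 * β2
        = δ ^ 2 * μ ^ 2 + δ ^ 2 / ν * μ + β2 * μ ^ 2 := by
      field_simp
    have h2 : μ ^ 2 ≤ √μ := hμ2.trans hs
    rw [h1, add_mul, add_mul]
    gcongr
  · have h1 : 2 / (1 - τ) * (μ ^ 2 * δ ^ 2) + μ ^ 2 * β2 = (2 * δ ^ 2 / (1 - τ) + β2) * μ ^ 2 := by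
      ring
    rw [h1]
    gcongr
  · have h1 : 2 / (1 - τ) * (μ ^ 2 * δ ^ 2) + μ ^ 2 * β2 = (2 * δ ^ 2 / (1 - τ) + β2) * μ ^ 2 := by
      ring
    rw [h1]
    gcongr

/-- The numerator is of order `μ²` and the determinant is at least `κμ`. -/
theorem mseBound_one_le {a b c d τ μ σs2 bsq κ B₃ B₄ k ξ : ℝ} (hμ : 0 < μ) (ha : 0 ≤ a)
    (hd : 0 ≤ d) (hb : 0 ≤ b) (hc : 0 ≤ c) (hbB : b ≤ B₃)
    (hcB : c ≤ B₄) (hκ : 0 < κ) (hdet : κ * μ ≤ (1 - a) * (1 - d) - b * c) (hτ : τ < 1)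
    (hσ : 0 ≤ σs2) (hk : 0 ≤ k) (hbsq0 : 0 ≤ bsq) (hbsq : bsq ≤ k * ξ ^ 2 * μ ^ 2) :
    mseBound 1 1 !![a, b; c, d] τ μ σs2 bsq
      ≤ ((1 + B₄) + (B₃ + 1) * (1 + 3 * k / (1 - τ))) / κ * (σs2 + ξ ^ 2) * μ := by
  have hτ' : 0 < 1 - τ := sub_pos.mpr hτ
  have hD : 0 < κ * μ := mul_pos hκ hμ
  rw [mseBound_one (hD.trans_le hdet).ne']
  have hp : μ ^ 2 * σs2 ≤ μ ^ 2 * (σs2 + ξ ^ 2) :=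
    mul_le_mul_of_nonneg_left (by linarith [sq_nonneg ξ]) (sq_nonneg μ)
  have hq : 3 * bsq / (1 - τ) ≤ 3 * k / (1 - τ) * (μ ^ 2 * (σs2 + ξ ^ 2)) :=
    calc 3 * bsq / (1 - τ) ≤ 3 * (k * (σs2 + ξ ^ 2) * μ ^ 2) / (1 - τ) := by
          gcongr
          refine hbsq.trans ?_
          gcongr
          linarith
      _ = _ := by ring
  have hp0 : 0 ≤ μ ^ 2 * σs2 := by positivity
  have hq0 : 0 ≤ 3 * bsq / (1 - τ) := by positivity
  have hB₃ : 0 ≤ B₃ := hb.trans hbB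
  have hB₄ : 0 ≤ B₄ := hc.trans hcB
  calc _ ≤ ((1 + B₄) * (μ ^ 2 * (σs2 + ξ ^ 2)) + (B₃ + 1) * (μ ^ 2 * (σs2 + ξ ^ 2)
        + 3 * k / (1 - τ) * (μ ^ 2 * (σs2 + ξ ^ 2)))) / (κ * μ) := by
        refine div_le_div₀ (by positivity) (add_le_add ?_ ?_) hD hdet
        · exact mul_le_mul (by linarith) hp hp0 (by positivity)
        · exact mul_le_mul (by linarith) (add_le_add hp hq) (by positivity) (by positivity)
    _ = _ := by field_simp

/-! ### The convergence theorem -/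

theorem theorem1 {K : ℕ} [NeZero K] (A : Matrix (Fin K) (Fin K) ℝ) (hA : IsCombinationMatrix A) :
    -- every problem has a gradient-noise bound
    (∀ (ν δ ξ : ℝ), 0 < ν → 0 < δ → ∀ (M : ℕ) (X : Type*) (L : LearningProblem K M X)
      (wo : Param M) (wloc : Fin K → Param M),
      L.ConvexSmooth ν δ → L.BoundedDrift wo wloc ξ →
      L.IsGradientNoiseBound wo (2 * δ ^ 2) (2 * ∑ k, L.gradientNoiseVariance k wo)) ∧
    -- mean-square convergence, for every gradient-noise bound
    ∃ (VR : Matrix (Fin K) (Fin (K - 1)) ℝ) (Jε : Matrix (Fin (K - 1)) (Fin (K - 1)) ℝ)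
      (v₁ v₂ : ℝ),
      IsEigendecomposition A VR Jε ∧ specRad Jε < 1 ∧ 0 < v₁ ∧ 0 < v₂ ∧
      ∀ (ε ν δ β2 : ℝ), 0 < ε → specRad Jε + ε < 1 → 0 < ν → 0 < δ → 0 ≤ β2 →
      ∃ (c₁ c₂ c₃ c₄ c₅ μ₀ C C' : ℝ),
        0 < c₁ ∧ 0 ≤ c₂ ∧ 0 ≤ c₃ ∧ 0 ≤ c₄ ∧ 0 ≤ c₅ ∧ 0 < μ₀ ∧ 0 ≤ C ∧ 0 ≤ C' ∧
        (∀ μ : ℝ, 0 < μ → μ ≤ μ₀ → specRad (rateMatrix c₁ c₂ c₃ c₄ c₅ (specRad Jε + ε) μ) < 1) ∧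
        ∀ (M : ℕ) (X : Type*) (L : LearningProblem K M X) (wo : Param M) (wloc : Fin K → Param M)
          (ξ σs2 : ℝ),
          L.ConvexSmooth ν δ → L.BoundedDrift wo wloc ξ → L.IsGradientNoiseBound wo β2 σs2 →
        ∀ μ : ℝ, 0 < μ → μ ≤ μ₀ →
          let τ := specRad Jε + ε
          let Γ := rateMatrix c₁ c₂ c₃ c₄ c₅ τ μ
          let bound := mseBound v₁ v₂ Γ τ μ σs2 (∑ j, ‖L.bias A VR μ wo j‖ ^ 2)
          -- the bound is an `O(μ)` neighbourhood
          bound ≤ C' * (σs2 + ξ ^ 2) * μ ∧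
          ∀ (Ω : Type*) (_ : MeasurableSpace Ω) (P : Measure Ω) (_ : IsProbabilityMeasure P)
            (G : LocalGraphHomomorphicProcess A M P) (σg : ℝ) (init : Ω → Fin K → Param M)
            (draw : (k : Fin K) → ℕ → Ω → Fin (L.N k)),
            0 < σg → Measurable init → (∀ k, MemLp (fun ω => init ω k) 2 P) →
            IsUniformSampling L P init draw →
            let W := privatizedATC L A G σg init draw μ
            (∀ i, Integrable (fun ω => sqError wo (W i ω)) P) ∧
            -- exponential convergence with the rate of `Γ`
            (∀ i, ∫ ω, sqError wo (W i ω) ∂P ≤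
              C * specRad Γ ^ i * ∫ ω, sqError wo (init ω) ∂P + bound) ∧
            -- the steady-state error
            limsup (fun i => ∫ ω, sqError wo (W i ω) ∂P) atTop ≤ bound := by
  refine ⟨fun ν δ ξ _ _ M X L wo wloc h _ => h.isGradientNoiseBound wo, ?_⟩
  obtain ⟨VR, J, hE⟩ := exists_isEigendecomposition hA.symm hA.stochastic
  -- The change of basis is orthogonal and preserves norms, hence `v₁ = v₂ = 1`.
  refine ⟨VR, J, 1, 1, hE, specRad_lt_one_of_isDiag hE.isDiag (hE.abs_diag_lt_one hA), one_pos,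
    one_pos, ?_⟩
  intro ε ν δ β2 hε hτ1 hν hδ hβ
  have hJ : ∀ j, |J j j| ≤ specRad J + ε := fun j =>
    (abs_diag_le_specRad hE.isDiag j).trans (by linarith)
  have hτ0 : 0 < specRad J + ε := by linarith [specRad_nonneg J]
  -- Only `0 < τ < 1` and `|J j j| ≤ τ` matter from here on; `ε > 0` makes `τ` positive even when
  -- `J` vanishes.
  generalize specRad J + ε = τ at hτ1 hJ hτ0 ⊢
  have hτ' : 0 < 1 - τ := sub_pos.mpr hτ1
  have hsτ : √τ < 1 := by rw [Real.sqrt_lt' one_pos]; simpa using hτ1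
  set c₂ := δ ^ 2 + ν * δ ^ 2 + β2 with hc₂
  set c₃ := δ ^ 2 + δ ^ 2 / ν + β2 with hc₃
  set c₄ := 2 * δ ^ 2 / (1 - τ) + β2 with hc₄
  have hc₂0 : 0 ≤ c₂ := by positivity
  have hc₃0 : 0 ≤ c₃ := by positivity
  have hc₄0 : 0 ≤ c₄ := by positivity
  obtain ⟨μ₀, hμ₀, hrate⟩ := exists_stepSize_bound (c₂ := c₂) (c₃ := c₃) (c₄ := c₄) (c₅ := c₄) hν hτ1
  have hη : 0 < (1 - √τ) / 2 := by linarith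
  have hκ : 0 < ν * (1 - √τ) / 8 := by have := sub_pos.mpr hsτ; positivity
  have hdet : ∀ μ, 0 < μ → μ ≤ μ₀ → 0 < (1 - (1 - ν * μ + c₂ * μ ^ 2)) * (1 - (√τ + c₄ * μ ^ 2))
      - c₃ * √μ * (c₄ * μ) := fun μ hμ hμ' =>
    (mul_pos hκ hμ).trans_le (hrate μ hμ hμ').2.2.2.2.2
  have hspec : ∀ μ, 0 < μ → μ ≤ μ₀ → specRad (rateMatrix ν c₂ c₃ c₄ c₄ τ μ) < 1 := by
    intro μ hμ hμ'
    obtain ⟨-, ha0, ha1, hd1, -, -⟩ := hrate μ hμ hμ'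
    exact specRad_fin_two_lt_one (by positivity) (by positivity) ha1 hd1 (hdet μ hμ hμ')
  -- `C` comes from the column-sum bound `1 + c₃ + c₄` and the eigenvalue gap `(1 - √τ) / 2`, `C'`
  -- from the determinant bound `ν (1 - √τ) / 8 * μ`.
  refine ⟨ν, c₂, c₃, c₄, c₄, μ₀, 2 * ((1 + c₃ + c₄) + 1) / ((1 - √τ) / 2),
    ((1 + c₄) + (c₃ + 1) * (1 + 3 * (K * δ ^ 2) / (1 - τ))) / (ν * (1 - √τ) / 8),
    hν, hc₂0, hc₃0, hc₄0, hc₄0, hμ₀, by positivity, by positivity, hspec, ?_⟩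
  intro M X L wo wloc ξ σs2 hL hd hG μ hμ hμ'
  obtain ⟨hμ1, ha0, ha1, hd1, had, hκdet⟩ := hrate μ hμ hμ'
  have hsμ : √μ ≤ 1 := by simpa using Real.sqrt_le_sqrt hμ1
  have hσ := hG.nonneg
  have hb : c₃ * √μ ≤ c₃ := mul_le_of_le_one_right hc₃0 hsμ
  have hc : c₄ * μ ≤ c₄ := mul_le_of_le_one_right hc₄0 hμ1
  have hbsq0 : 0 ≤ ∑ j, ‖L.bias A VR μ wo j‖ ^ 2 := by positivity
  refine ⟨mseBound_one_le hμ ha0 (by positivity) (by positivity) (by positivity) hb hc hκ hκdet hτ1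
    hσ (by positivity) hbsq0
    (sum_norm_bias_sq_le hL hδ.le hE (fun j => (hJ j).trans hτ1.le) hd μ), ?_⟩
  intro Ω _ P _ G σg init draw _ hinit hinitL hS
  rw [privatizedATC_eq_diffusionATC L hA.stochastic]
  intro W
  have hWm : ∀ i, Measurable (W i) := fun i =>
    measurable_diffusionATC hL hinit i (fun k j _ => hS.measurable k j) le_rfl
  have hWL : ∀ i k, MemLp (fun ω => W i ω k) 2 P := memLp_diffusionATC hL hinit hinitL hS.measurable
  have hstep := fun i => integral_diffusionStep_le (W := W i) (W' := W (i + 1)) hL hν hA.stochastic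
    hE hJ hτ0 hτ1 hd.global_optimal hG (hWm i) (hWL i) (fun k => hS.measurable k i)
    (indepFun_diffusionATC hL hS i) (fun k n => hS.uniform k i n) hμ (fun _ => rfl) (hWL (i + 1))
  have hsplit := fun i => integral_sqError_eq (wo := wo) hE (hWL i)
  set x : ℕ → ℝ := fun i => ∫ ω, centroidError wo (W i ω) ∂P with hx
  set y : ℕ → ℝ := fun i => ∫ ω, disagreement VR wo (W i ω) ∂P with hy
  have hx0 : ∀ i, 0 ≤ x i := fun i => integral_nonneg fun ω => centroidError_nonneg _ _
  have hy0 : ∀ i, 0 ≤ y i := fun i => integral_nonneg fun ω => disagreement_nonneg _ _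
  obtain ⟨r1, r2, r3, r4⟩ := rate_coefficients_le (δ := δ) hν hβ hτ0 hτ1 hμ hμ1
  have hbound : ∀ i, ∫ ω, sqError wo (W i ω) ∂P ≤
      2 * ((1 + c₃ + c₄) + 1) / ((1 - √τ) / 2) * specRad (rateMatrix ν c₂ c₃ c₄ c₄ τ μ) ^ i
        * ∫ ω, sqError wo (init ω) ∂P
      + mseBound 1 1 (rateMatrix ν c₂ c₃ c₄ c₄ τ μ) τ μ σs2 (∑ j, ‖L.bias A VR μ wo j‖ ^ 2) := by
    intro i
    rw [hsplit i, show ∫ ω, sqError wo (init ω) ∂P = x 0 + y 0 from hsplit 0, rateMatrix,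
      mseBound_one (hdet μ hμ hμ').ne']
    refine add_le_of_affine_recursion (x := x) (y := y) (s := 1 + c₃ + c₄)
      (p := μ ^ 2 * σs2) (q := μ ^ 2 * σs2 + 3 * (∑ j, ‖L.bias A VR μ wo j‖ ^ 2) / (1 - τ)) ha0
      (by positivity : 0 ≤ c₃ * √μ) (by positivity : 0 ≤ c₄ * μ) (by positivity) ha1 hd1
      (hdet μ hμ hμ') hη had (by linarith) (by linarith) (by positivity) (by positivity)
      (hx0 0) (hy0 0) (fun i => ?_) (fun i => ?_) i
    · have h1 := (hstep i).1
      rw [hsplit i] at h1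
      have h2 := mul_le_mul_of_nonneg_right r1 (hx0 i)
      have h3 := mul_le_mul_of_nonneg_right r2 (hy0 i)
      simp only [hx, hy] at h1 h2 h3 ⊢
      linarith
    · have h1 := (hstep i).2
      rw [hsplit i] at h1
      have h2 := mul_le_mul_of_nonneg_right r3 (hx0 i)
      have h3 := mul_le_mul_of_nonneg_right r4 (hy0 i)
      -- The recursion yields the factor `2` for the bias; the stated bound allows `3`.
      have h4 : 2 / (1 - τ) * ∑ j, ‖L.bias A VR μ wo j‖ ^ 2
          ≤ 3 * (∑ j, ‖L.bias A VR μ wo j‖ ^ 2) / (1 - τ) := by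
        rw [div_mul_eq_mul_div]
        gcongr
        norm_num
      simp only [hx, hy] at h1 h2 h3 ⊢
      linarith
  refine ⟨fun i => integrable_sqError (hWL i), hbound, ?_⟩
  refine limsup_le_of_le_geometric (fun i => integral_nonneg fun ω => ?_) (specRad_nonneg _)
    (hspec μ hμ hμ') fun i => (hbound i).trans (le_of_eq (by rw [mul_right_comm]))
  exact Finset.sum_nonneg fun k _ => sq_nonneg _
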